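/- Conventions. A *correction function* is a non-decreasing $\alpha:\mathbb N\to\mathbb N$ with $\alpha(n)\ge n$ for all $n$, extended by $\alpha(\infty)=\infty$. For $f,g:E\to\mathbb N\cup\{\infty\}$ write $f\approx g$ if there is a correction function $\alpha$ with $f\le\alpha\circ g$ and $g\le\alpha\circ f$; a *cost function* over $E$ is an equivalence class of $\approx$. A *stabilisation monoid* is a finite ordered monoid $(M,\cdot,1,\le)$ (with $\cdot$ monotone in both arguments) together with a map $\sharp:E(M)\to E(M)$ on its set $E(M)$ of idempotents such that $e\le f$ implies $e^\sharp\le f^\sharp$; $(ab)^\sharp=a(ba)^\sharp b$ whenever $ab,ba\in E(M)$; $e^\sharp\le e$; $(e^\sharp)^\sharp=e^\sharp$; and $1^\sharp=1$. For $n\in\mathbb N$, an *$n$-computation* for a word $u\in M^+$ is a finite ordered tree whose nodes are labelled by values in $M$, whose leaves correspond from left to right to the letters of $u$, and in which the value of each node is: the corresponding letter, for a leaf; the product of the values of its two children, for a binary node; $e$, for a node with $2\le k\le n$ children, all of the same idempotent value $e$; $e^\sharp$, for a node with $k>n$ children ($k\geq 1$), all of the same idempotent value $e$. For *$n$-under-computations*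 (*$n$-over-computations*) each value is only required to be $\le$ (resp. $\ge$) the prescribed one. The value of the tree is that of its root, and leaves do not count in its height. A computation of any of the three kinds for $u\in M^*$ is one for some $v\in M^+$ from which $u$ is obtained by deleting some occurrences of the letter $1$. Let $A$ be a finite alphabet, $h:A\to M$ a mapping (applied letter by letter to words) and $I\subseteq M$ a downward closed set. The triple $(M,h,I)$ *recognises* a cost function $F$ over $A^*$ if for every $p\ge 3|M|$ the four functions of $u\in A^*$ $$\inf\{n:\text{there is an }n\text{-under-computation of height}\le p\text{ for }h(u)\text{ with value in }M\setminus I\},$$ $$\inf\{n:\text{there is an }n\text{-computation of height}\le p\text{ for }h(u)\text{ with value in }M\setminus I\},$$ $$\sup\{n+1:\text{there is an }n\text{-computation of height}\le p\text{ for }h(u)\text{ with value in }I\},$$ $$\sup\{n+1:\text{there is an }n\text{-over-computation of height}\le p\text{ for }h(u)\text{ with value in }I\}$$ all belong to $F$ (with $\inf\emptyset=\infty$ and $\sup\emptyset=0$). A cost function over $A^*$ is *recognisable* if some such triple recognises it. For a mapping $z:A\to B$ between finite alphabets, extended letter by letter to words, the *sup-projection* of $f:A^*\to\mathbb N\cup\{\infty\}$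 is $f_{\sup,z}:B^*\to\mathbb N\cup\{\infty\}$, $f_{\sup,z}(v)=\sup\{f(u): u\in A^*,\ z(u)=v\}$; it is compatible with $\approx$, hence defined on cost functions. **Theorem.** Recognisable cost functions are effectively closed under sup-projection. That is: 1. If $A,B$ are finite alphabets, $z:A\to B$ is a mapping and $F$ is a recognisable cost function over $A^*$, then the cost function $F_{\sup,z}$ over $B^*$ is recognisable. 2. There is an algorithm (a computable function) which, given the finite tables of a stabilisation monoid $M$, of a mapping $h:A\to M$, of a downward closed set $I\subseteq M$ and of a mapping $z:A\to B$ between finite alphabets, outputs the finite tables of a stabilisation monoid $M'$, of a mapping $h':B\to M'$ and of a downward closed set $I'\subseteq M'$ such that, if $(M,h,I)$ recognises a cost function $F$ over $A^*$, then $(M',h',I')$ recognises $F_{\sup,z}$. -/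

import Mathlib

namespace CostFun

/-! ### Cost functions -/

/-- A correction function: a non-decreasing `α : ℕ → ℕ` with `n ≤ α n` for all `n`. -/
def IsCorrection (α : ℕ → ℕ) : Prop :=
  Monotone α ∧ ∀ n, n ≤ α n

/-- The extension of `α` to `ℕ∞` with value `∞` at `∞`. -/
def extend (α : ℕ → ℕ) : ℕ∞ → ℕ∞
  | ⊤ => ⊤
  | (n : ℕ) => (α n : ℕ∞)

/-- `f ≼_α g`, that is, `f ≤ extend α ∘ g` pointwise. -/
def DomBy {E : Type*} (α : ℕ → ℕ) (f g : E → ℕ∞) : Prop :=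
  ∀ x, f x ≤ extend α (g x)

/-- `f ≈ g`: for some correction function `α`, both `f ≼_α g` and `g ≼_α f`. -/
def CostEquiv {E : Type*} (f g : E → ℕ∞) : Prop :=
  ∃ α, IsCorrection α ∧ DomBy α f g ∧ DomBy α g f

theorem extend_mono {α : ℕ → ℕ} (hα : Monotone α) : Monotone (extend α) := by
  intro x y hxy
  induction y using ENat.recTopCoe with
  | top => exact le_top
  | coe n =>
    induction x using ENat.recTopCoe with
    | top => exact absurd hxy (by simp)
    | coe m => exact Nat.cast_le.2 (hα (Nat.cast_le.1 hxy))

theorem extend_comp (α β : ℕ → ℕ) (x : ℕ∞) :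
    extend (α ∘ β) x = extend α (extend β x) := by
  induction x using ENat.recTopCoe <;> rfl

theorem extend_le_extend {α β : ℕ → ℕ} (h : ∀ n, α n ≤ β n) (x : ℕ∞) :
    extend α x ≤ extend β x := by
  induction x using ENat.recTopCoe with
  | top => exact le_rfl
  | coe n => exact Nat.cast_le.2 (h n)

theorem DomBy.trans {E : Type*} {α β γ : ℕ → ℕ} {f g h : E → ℕ∞} (hα : Monotone α)
    (hγ : ∀ n, α (β n) ≤ γ n) (hfg : DomBy α f g) (hgh : DomBy β g h) : DomBy γ f h := fun x =>
  ((hfg x).trans (extend_mono hα (hgh x))).trans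
    ((extend_comp α β _).symm.le.trans (extend_le_extend hγ _))

theorem costEquiv_refl {E : Type*} (f : E → ℕ∞) : CostEquiv f f := by
  have h : DomBy id f f := by
    intro x
    have : ∀ y : ℕ∞, extend id y = y := fun y => by induction y using ENat.recTopCoe <;> rfl
    exact (this _).ge
  exact ⟨id, ⟨monotone_id, fun _ => le_rfl⟩, h, h⟩

theorem CostEquiv.symm {E : Type*} {f g : E → ℕ∞} : CostEquiv f g → CostEquiv g f :=
  fun ⟨α, hα, h1, h2⟩ => ⟨α, hα, h2, h1⟩

theorem CostEquiv.trans {E : Type*} {f g h : E → ℕ∞} :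
    CostEquiv f g → CostEquiv g h → CostEquiv f h := by
  rintro ⟨α, hα, h1, h2⟩ ⟨β, hβ, h3, h4⟩
  refine ⟨fun n => α (β n) + β (α n), ⟨fun m n hmn => ?_, fun n => ?_⟩, ?_, ?_⟩
  · exact add_le_add (hα.1 (hβ.1 hmn)) (hβ.1 (hα.1 hmn))
  · exact ((hβ.2 n).trans (hα.2 _)).trans (Nat.le_add_right _ _)
  · exact h1.trans hα.1 (fun n => Nat.le_add_right _ _) h3
  · exact h4.trans hβ.1 (fun n => Nat.le_add_left _ _) h2

/-- The equivalence relation `≈` on functions `E → ℕ∞`. -/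
def costSetoid (E : Type*) : Setoid (E → ℕ∞) where
  r := CostEquiv
  iseqv := ⟨costEquiv_refl, CostEquiv.symm, CostEquiv.trans⟩

/-- A cost function over `E`: an equivalence class of `≈`. -/
def CostFunction (E : Type*) : Type _ := Quotient (costSetoid E)

/-- The cost function of a function `E → ℕ∞`. -/
def CostFunction.mk {E : Type*} (f : E → ℕ∞) : CostFunction E := Quotient.mk (costSetoid E) f

/-- The sup-projection of `f` with respect to `z`, extended letter by letter to words:
`v ↦ sup {f u : z u = v}` (so `0` if `v` has no preimage). -/
noncomputable def supProj {A B : Type*} (z : A → B) (f : List A → ℕ∞) (v : List B) : ℕ∞ :=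
  sSup (f '' {u : List A | u.map z = v})

theorem DomBy.supProj {A B : Type*} (z : A → B) {α : ℕ → ℕ} (hα : Monotone α)
    {f g : List A → ℕ∞} (h : DomBy α f g) : DomBy α (supProj z f) (supProj z g) := by
  intro v
  refine sSup_le ?_
  rintro _ ⟨u, hu, rfl⟩
  exact (h u).trans (extend_mono hα (le_sSup ⟨u, hu, rfl⟩))

/-- The sup-projection of a cost function (it does not depend on the representative). -/
noncomputable def CostFunction.supProj {A B : Type*} (z : A → B) :
    CostFunction (List A) → CostFunction (List B) :=
  Quotient.map (sa := costSetoid (List A)) (sb := costSetoid (List B)) (CostFun.supProj z)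
    (fun _ _ ⟨α, hα, h1, h2⟩ => ⟨α, hα, h1.supProj z hα.1, h2.supProj z hα.1⟩)

/-! ### Stabilisation monoids and computations -/

/-- A stabilisation monoid: a finite ordered monoid with a stabilisation operator
`sharp : E(M) → E(M)` on its idempotents. -/
class StabilisationMonoid (M : Type*) extends Monoid M, PartialOrder M where
  finite : Finite M
  mul_mono : ∀ a a' b b' : M, a ≤ a' → b ≤ b' → a * b ≤ a' * b'
  sharp : {e : M // IsIdempotentElem e} → {e : M // IsIdempotentElem e}
  sharp_mono : ∀ e f : {e : M // IsIdempotentElem e}, (e : M) ≤ f → (sharp e : M) ≤ sharp f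
  sharp_consistent : ∀ (a b : M) (hab : IsIdempotentElem (a * b)) (hba : IsIdempotentElem (b * a)),
    (sharp ⟨a * b, hab⟩ : M) = a * sharp ⟨b * a, hba⟩ * b
  sharp_le : ∀ e : {e : M // IsIdempotentElem e}, (sharp e : M) ≤ e
  sharp_sharp : ∀ e : {e : M // IsIdempotentElem e}, sharp (sharp e) = sharp e
  sharp_one : (sharp ⟨1, IsIdempotentElem.one⟩ : M) = 1

open StabilisationMonoid (sharp)

/-- `HasComp r n p u a`: there is a computation tree with threshold `n`, height at most `p`
(leaves do not count) and value `a` for the word `u`, where `r` relates the value of a node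
to the value prescribed by its children (or by the letter, for a leaf).
Taking `r` to be `≤`, `≥`, `=` gives `n`-under-computations, `n`-over-computations and
`n`-computations. The list `us` consists of the words below the children of the node. -/
inductive HasComp {M : Type*} [StabilisationMonoid M] (r : M → M → Prop) (n : ℕ) :
    ℕ → List M → M → Prop
  | leaf (p : ℕ) (a v : M) (hv : r v a) : HasComp r n p [a] v
  | binary (p : ℕ) (u₁ u₂ : List M) (x y v : M) (h₁ : HasComp r n p u₁ x)
      (h₂ : HasComp r n p u₂ y) (hv : r v (x * y)) : HasComp r n (p + 1) (u₁ ++ u₂) v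
  | idempotent (p : ℕ) (us : List (List M)) (e : {e : M // IsIdempotentElem e}) (v : M)
      (h2 : 2 ≤ us.length) (hn : us.length ≤ n) (h : ∀ u ∈ us, HasComp r n p u e)
      (hv : r v e) : HasComp r n (p + 1) us.flatten v
  | stabilisation (p : ℕ) (us : List (List M)) (e : {e : M // IsIdempotentElem e}) (v : M)
      (hn : n < us.length) (h : ∀ u ∈ us, HasComp r n p u e)
      (hv : r v (sharp e)) : HasComp r n (p + 1) us.flatten v

/-- `EraseOnes v u`: the word `u` is obtained from `v` by deleting some occurrences of the
letter `1`. -/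
inductive EraseOnes {M : Type*} [One M] : List M → List M → Prop
  | nil : EraseOnes [] []
  | keep (a : M) (v u : List M) (h : EraseOnes v u) : EraseOnes (a :: v) (a :: u)
  | erase (v u : List M) (h : EraseOnes v u) : EraseOnes (1 :: v) u

/-- Computations in a stabilisation monoid for a possibly empty word `u`: computations for some
word from which `u` is obtained by deleting some letters `1`. -/
def HasSMComp {M : Type*} [StabilisationMonoid M] (r : M → M → Prop) (n p : ℕ)
    (u : List M) (a : M) : Prop :=
  ∃ v, EraseOnes v u ∧ HasComp r n p v a

/-! ### Recognisable cost functions -/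

/-- Infimum of the `n` such that there is an `n`-[under/over]-computation (according to `r`) of
height at most `p` for `h u` with value outside of `I`. -/
noncomputable def semInf {A M : Type*} [StabilisationMonoid M] (r : M → M → Prop) (h : A → M)
    (I : LowerSet M) (p : ℕ) (u : List A) : ℕ∞ :=
  sInf {x | ∃ n : ℕ, x = n ∧ ∃ a, a ∉ I ∧ HasSMComp r n p (u.map h) a}

/-- Supremum of the `n + 1` such that there is an `n`-[under/over]-computation (according to `r`)
of height at most `p` for `h u` with value in `I`. -/
noncomputable def semSup {A M : Type*} [StabilisationMonoid M] (r : M → M → Prop) (h : A → M)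
    (I : LowerSet M) (p : ℕ) (u : List A) : ℕ∞ :=
  sSup {x | ∃ n : ℕ, x = n + 1 ∧ ∃ a, a ∈ I ∧ HasSMComp r n p (u.map h) a}

/-- The triple `M, h, I` (with `I` an ideal, i.e. a downward closed subset of `M`) recognises the
cost function `F`: for every height `p ≥ 3|M|`, the four functions defined from
under-computations, computations (twice) and over-computations all belong to `F`. -/
def Recognises {A M : Type*} [StabilisationMonoid M] (h : A → M) (I : LowerSet M)
    (F : CostFunction (List A)) : Prop :=
  ∀ p : ℕ, 3 * Nat.card M ≤ p →
    CostFunction.mk (semInf (fun x y => x ≤ y) h I p) = F ∧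
    CostFunction.mk (semInf (fun x y => x = y) h I p) = F ∧
    CostFunction.mk (semSup (fun x y => x = y) h I p) = F ∧
    CostFunction.mk (semSup (fun x y => x ≥ y) h I p) = F

/-- A cost function is recognisable if some stabilisation monoid (together with a mapping and
an ideal) recognises it. Stabilisation monoids are finite, so `Type` is large enough. -/
def IsRecognisable {A : Type*} (F : CostFunction (List A)) : Prop :=
  ∃ (M : Type) (_ : StabilisationMonoid M) (h : A → M) (I : LowerSet M), Recognises h I F

/-! ### Finite presentations, as inputs and outputs of algorithms -/

/-- Finite presentation of a triple `M, h, I`, as numbers and tables: the neutral element, the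
table of the product, the table of the order, the table of the stabilisation, the table of `h`
and the table of `I`. -/
abbrev RecogniserCode : Type :=
  ℕ × List (List ℕ) × List (List Bool) × List (Option ℕ) × List ℕ × List Bool

/-- Finite presentation of a mapping between finite alphabets: the size of the target alphabet
and the table of the mapping. -/
abbrev MapCode : Type := ℕ × List ℕ

open Classical in
/-- The presentation of `M, h, I` relative to enumerations of the alphabet and of `M`. -/
noncomputable def recogniserCode {A M : Type*} [StabilisationMonoid M] {k m : ℕ}
    (eA : Fin k ≃ A) (eM : Fin m ≃ M) (h : A → M) (I : LowerSet M) : RecogniserCode :=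
  ((eM.symm 1 : ℕ),
   List.ofFn fun i => List.ofFn fun j => (eM.symm (eM i * eM j) : ℕ),
   List.ofFn fun i => List.ofFn fun j => decide (eM i ≤ eM j),
   List.ofFn fun i =>
     if he : IsIdempotentElem (eM i) then some (eM.symm (sharp ⟨eM i, he⟩ : M) : ℕ) else none,
   List.ofFn fun c => (eM.symm (h (eA c)) : ℕ),
   List.ofFn fun i => decide (eM i ∈ I))

/-- The presentation of `z : A → B` relative to enumerations of both alphabets. -/
def mapCode {A B : Type*} {k l : ℕ} (eA : Fin k ≃ A) (eB : Fin l ≃ B) (z : A → B) : MapCode :=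
  (l, List.ofFn fun c => (eB.symm (z (eA c)) : ℕ))

end CostFun

/-! The sup-projection is recognised by a power construction. A letter `b` is sent to the upward
closure of the values `h a` with `z a = b`, and `UpSet M` is ordered by reverse inclusion, so that
the sets meeting `I` form an ideal. The product is elementwise up to closure, and the stabilisation
of an idempotent `E` is the least upward closed set that contains `E` and is closed under product
and stabilisation: many factors freely chosen in `E` can be made to yield any of its elements, and
never anything else. The delicate axiom, consistency, is `UpSet.gen_mul`.

Two liftings relate the thresholds. An under-computation of value `X` over `UpSet M` gives, for
every choice of elements in the letters, an exact computation over `M` with the same threshold and a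
value in `X` (`exists_exactComp_of_under`). An over-computation of value `X` with a large threshold
gives, for every `x` in `X`, some choice of elements with an over-computation of value `x`
(`exists_overComp_of_over`). Hence the four functions of the new recogniser lie in a chain from the
sup-projection of an infimum for `M`, at a larger height, up to a function dominated by the
sup-projection of a supremum for `M`. Both ends represent the projected cost function
(`recognises_supProj`).

The middle link, infimum below supremum, needs an exact computation of bounded height for every word
and threshold. This is `exists_exactComp`, a factorisation argument by induction on the rank of
two-sided ideals. Its bound `compBound` is cubic instead of `3|M|`, and recognition speaks of all
heights from three times the size of the monoid on; so `UpSet M` is multiplied by a long enough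
`Chain`, which makes that threshold exceed `compBound` and changes nothing else.

For the algorithm, an element of the product is coded by a number whose low bits describe the set
and whose quotient is the position in the chain. All the tables are then found by bounded search,
hence are primitive recursive. -/

namespace CostFun

open StabilisationMonoid (sharp)

/-! ### Basic operations on computation trees -/

section Basic

variable {M : Type*} [StabilisationMonoid M] {r : M → M → Prop} {n : ℕ}

theorem HasComp.height_mono {p q : ℕ} {u : List M} {a : M} (h : HasComp r n p u a)
    (hpq : p ≤ q) : HasComp r n q u a := by
  induction h generalizing q with
  | leaf p a v hv => exact .leaf q a v hv
  | binary p u₁ u₂ x y v h₁ h₂ hv ih₁ ih₂ =>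
    obtain ⟨q, rfl⟩ : ∃ q', q = q' + 1 := ⟨q - 1, by omega⟩
    exact .binary q u₁ u₂ x y v (ih₁ (by omega)) (ih₂ (by omega)) hv
  | idempotent p us e v h2 hn h hv ih =>
    obtain ⟨q, rfl⟩ : ∃ q', q = q' + 1 := ⟨q - 1, by omega⟩
    exact .idempotent q us e v h2 hn (fun u hu => ih u hu (by omega)) hv
  | stabilisation p us e v hn h hv ih =>
    obtain ⟨q, rfl⟩ : ∃ q', q = q' + 1 := ⟨q - 1, by omega⟩
    exact .stabilisation q us e v hn (fun u hu => ih u hu (by omega)) hv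

theorem HasComp.relax (hr : ∀ x y z, r x y → r y z → r x z) {p : ℕ} {u : List M} {a b : M}
    (h : HasComp r n p u a) (hb : r b a) : HasComp r n p u b := by
  cases h with
  | leaf p a v hv => exact .leaf _ _ _ (hr _ _ _ hb hv)
  | binary p u₁ u₂ x y v h₁ h₂ hv => exact .binary _ _ _ _ _ _ h₁ h₂ (hr _ _ _ hb hv)
  | idempotent p us e v h2 hn h hv => exact .idempotent _ _ _ _ h2 hn h (hr _ _ _ hb hv)
  | stabilisation p us e v hn h hv => exact .stabilisation _ _ _ _ hn h (hr _ _ _ hb hv)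

theorem exists_flatten_of_map_eq_flatten {α β : Type*} (f : α → β) :
    ∀ (us : List (List β)) (ps : List α), ps.map f = us.flatten →
      ∃ pss : List (List α), ps = pss.flatten ∧ us = pss.map (List.map f)
  | [], ps, h => ⟨[], by simpa using h, rfl⟩
  | u :: us, ps, h => by
    rw [List.flatten_cons, List.map_eq_append_iff] at h
    obtain ⟨p₁, p₂, rfl, rfl, h₂⟩ := h
    obtain ⟨pss, rfl, rfl⟩ := exists_flatten_of_map_eq_flatten f us p₂ h₂
    exact ⟨p₁ :: pss, rfl, rfl⟩

theorem flatMap_flatten_eq {α β : Type*} (g : α → List β) (pss : List (List α)) :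
    pss.flatten.flatMap g = (pss.map fun ps => ps.flatMap g).flatten := by
  induction pss with
  | nil => rfl
  | cons ps pss ih => simp [ih]

/-- Substitution of computations for the letters of a word. -/
theorem HasComp.bind (hr : ∀ x y z, r x y → r y z → r x z) {p q : ℕ} {w : List M} {a : M}
    (h : HasComp r n q w a) (ps : List (M × List M)) (hw : ps.map Prod.fst = w)
    (hps : ∀ x ∈ ps, HasComp r n p x.2 x.1) : HasComp r n (q + p) (ps.flatMap Prod.snd) a := by
  induction h generalizing ps with
  | leaf q a v hv =>
    obtain ⟨x, rfl⟩ : ∃ x, ps = [x] := by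
      cases ps with
      | nil => simp at hw
      | cons x t => cases t with
        | nil => exact ⟨x, rfl⟩
        | cons y t => simp at hw
    simp only [List.map_cons, List.map_nil, List.cons.injEq, and_true] at hw
    subst hw
    simpa using ((hps x (by simp)).relax hr hv).height_mono (Nat.le_add_left p q)
  | binary q u₁ u₂ x y v h₁ h₂ hv ih₁ ih₂ =>
    rw [List.map_eq_append_iff] at hw
    obtain ⟨p₁, p₂, rfl, e₁, e₂⟩ := hw
    rw [List.flatMap_append, Nat.add_right_comm]
    exact .binary _ _ _ x y v (ih₁ p₁ e₁ fun x hx => hps x (by simp [hx]))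
      (ih₂ p₂ e₂ fun x hx => hps x (by simp [hx])) hv
  | idempotent q us e v h2 hn h hv ih =>
    obtain ⟨pss, rfl, rfl⟩ := exists_flatten_of_map_eq_flatten _ _ _ hw
    rw [flatMap_flatten_eq, Nat.add_right_comm]
    refine .idempotent _ _ e v (by simpa using h2) (by simpa using hn) ?_ hv
    intro u hu
    obtain ⟨ps, hps', rfl⟩ := List.mem_map.1 hu
    exact ih _ (List.mem_map_of_mem hps') ps rfl
      fun x hx => hps x (List.mem_flatten.2 ⟨ps, hps', hx⟩)
  | stabilisation q us e v hn h hv ih =>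
    obtain ⟨pss, rfl, rfl⟩ := exists_flatten_of_map_eq_flatten _ _ _ hw
    rw [flatMap_flatten_eq, Nat.add_right_comm]
    refine .stabilisation _ _ e v (by simpa using hn) ?_ hv
    intro u hu
    obtain ⟨ps, hps', rfl⟩ := List.mem_map.1 hu
    exact ih _ (List.mem_map_of_mem hps') ps rfl
      fun x hx => hps x (List.mem_flatten.2 ⟨ps, hps', hx⟩)

theorem HasComp.imp {r' : M → M → Prop} (hr : ∀ x y, r x y → r' x y) {p : ℕ} {u : List M} {a : M}
    (h : HasComp r n p u a) : HasComp r' n p u a := by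
  induction h with
  | leaf p a v hv => exact .leaf _ _ _ (hr _ _ hv)
  | binary p u₁ u₂ x y v h₁ h₂ hv ih₁ ih₂ => exact .binary _ _ _ _ _ _ ih₁ ih₂ (hr _ _ hv)
  | idempotent p us e v h2 hn h hv ih => exact .idempotent _ _ _ _ h2 hn ih (hr _ _ hv)
  | stabilisation p us e v hn h hv ih => exact .stabilisation _ _ _ _ hn ih (hr _ _ hv)

theorem HasComp.ne_nil {p : ℕ} {u : List M} {a : M} (h : HasComp r n p u a) : u ≠ [] := by
  induction h with
  | leaf => simp
  | binary p u₁ u₂ x y v h₁ h₂ hv ih₁ ih₂ => simp [ih₁]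
  | idempotent p us e v h2 hn h hv ih =>
    cases us with
    | nil => simp at h2
    | cons u us => simp [ih u (by simp)]
  | stabilisation p us e v hn h hv ih =>
    cases us with
    | nil => simp at hn
    | cons u us => simp [ih u (by simp)]

theorem pow_eq_of_idempotent {e : M} (he : IsIdempotentElem e) {k : ℕ} (hk : k ≠ 0) :
    e ^ k = e := by
  obtain ⟨k, rfl⟩ := Nat.exists_eq_succ_of_ne_zero hk
  exact he.pow_succ_eq k

theorem prod_le_prod_of_forall {l : List M} {e : M} (hl : ∀ x ∈ l, e ≤ x) :
    e ^ l.length ≤ l.prod := by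
  induction l with
  | nil => simp
  | cons a l ih =>
    rw [List.length_cons, pow_succ', List.prod_cons]
    exact StabilisationMonoid.mul_mono _ _ _ _ (hl a (by simp)) (ih fun x hx => hl x (by simp [hx]))

/-- Stabilisation only lowers an idempotent. This later lets an exact computation be relaxed to an
over-computation of any value above the product of the letters. -/
theorem HasComp.le_prod (hr : ∀ x y, r x y → x ≤ y) {p : ℕ} {u : List M} {a : M}
    (h : HasComp r n p u a) : a ≤ u.prod := by
  induction h with
  | leaf p a v hv => simpa using hr _ _ hv
  | binary p u₁ u₂ x y v h₁ h₂ hv ih₁ ih₂ =>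
    rw [List.prod_append]
    exact (hr _ _ hv).trans (StabilisationMonoid.mul_mono _ _ _ _ ih₁ ih₂)
  | idempotent p us e v h2 hn h hv ih =>
    rw [List.prod_flatten]
    refine (hr _ _ hv).trans ?_
    have := prod_le_prod_of_forall (l := us.map List.prod) (e := (e : M)) (by simpa using ih)
    rwa [pow_eq_of_idempotent e.2 (by simp; rintro rfl; simp at h2)] at this
  | stabilisation p us e v hn h hv ih =>
    rw [List.prod_flatten]
    refine ((hr _ _ hv).trans (StabilisationMonoid.sharp_le e)).trans ?_
    have := prod_le_prod_of_forall (l := us.map List.prod) (e := (e : M)) (by simpa using ih)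
    rwa [pow_eq_of_idempotent e.2 (by simp; rintro rfl; simp at hn)] at this

end Basic

/-! ### The preorder `x ∈ M y M` -/

section JOrder

variable {M : Type*} [Monoid M]

/-- `JLe x y`: the element `x` belongs to the two-sided ideal generated by `y`. -/
def JLe (x y : M) : Prop := ∃ a b, x = a * y * b

theorem JLe.refl (x : M) : JLe x x := ⟨1, 1, by simp⟩

theorem JLe.trans {x y z : M} : JLe x y → JLe y z → JLe x z := by
  rintro ⟨a, b, rfl⟩ ⟨c, d, rfl⟩
  exact ⟨a * c, d * b, by simp only [mul_assoc]⟩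

theorem JLe.mul_left (x y : M) : JLe (x * y) y := ⟨x, 1, by simp⟩

theorem JLe.mul_right (x y : M) : JLe (x * y) x := ⟨1, y, by simp⟩

/-- The number of elements of the two-sided ideal generated by `x`. -/
noncomputable def jRank (x : M) : ℕ := {y : M | JLe y x}.ncard

variable [Finite M]

theorem jRank_mono {x y : M} (h : JLe x y) : jRank x ≤ jRank y :=
  Set.ncard_le_ncard (fun _ hz => hz.trans h) (Set.toFinite _)

theorem JLe.of_jRank_le {x y : M} (h : JLe x y) (hr : jRank y ≤ jRank x) : JLe y x := by
  have : {z : M | JLe z x} = {z : M | JLe z y} :=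
    Set.eq_of_subset_of_ncard_le (fun _ hz => JLe.trans hz h) hr (Set.toFinite _)
  have hy : y ∈ {z : M | JLe z y} := JLe.refl y
  rwa [← this] at hy

theorem jRank_pos (x : M) : 0 < jRank x :=
  (Set.ncard_pos (Set.toFinite _)).2 ⟨x, JLe.refl x⟩

theorem jRank_le_card (x : M) : jRank x ≤ Nat.card M := by
  rw [← Set.ncard_univ]
  exact Set.ncard_le_ncard (Set.subset_univ _) (Set.toFinite _)

theorem exists_pow_idempotent (x : M) : ∃ k, k ≠ 0 ∧ IsIdempotentElem (x ^ k) := by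
  obtain ⟨i, j, hij, h⟩ : ∃ i j : ℕ, i < j ∧ x ^ i = x ^ j := by
    have : ¬ Function.Injective fun i : ℕ => x ^ i := not_injective_infinite_finite _
    simp only [Function.Injective, not_forall] at this
    obtain ⟨i, j, h, hne⟩ := this
    rcases Nat.lt_or_gt_of_ne hne with h' | h'
    · exact ⟨i, j, h', h⟩
    · exact ⟨j, i, h', h.symm⟩
  obtain ⟨d, rfl⟩ := Nat.exists_eq_add_of_lt hij
  have step : ∀ m, i ≤ m → x ^ (m + (d + 1)) = x ^ m := by
    intro m hm
    obtain ⟨c, rfl⟩ := Nat.exists_eq_add_of_le hm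
    rw [show i + c + (d + 1) = (i + d + 1) + c by ring, pow_add, ← h, ← pow_add]
  have steps : ∀ t m, i ≤ m → x ^ (m + t * (d + 1)) = x ^ m := by
    intro t
    induction t with
    | zero => simp
    | succ t ih =>
      intro m hm
      rw [Nat.succ_mul, ← add_assoc, step _ (by omega), ih m hm]
  refine ⟨(i + 1) * (d + 1), by positivity, ?_⟩
  rw [IsIdempotentElem, ← pow_add]
  exact steps _ _ (by nlinarith)

/-- If `x = s g` generates the same two-sided ideal as `s`, then `s ∈ x M`. -/
theorem exists_eq_mul_of_jLe {s g : M} (h : JLe s (s * g)) : ∃ q, s = s * g * q := by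
  obtain ⟨a, b, hs⟩ := h
  -- The equation `s = a s (g b)` is iterated up to an idempotent power of `g b`, which then fixes
  -- `s` on the right.
  have key : ∀ k, s = a ^ k * s * (g * b) ^ k := by
    intro k
    induction k with
    | zero => simp
    | succ k ih =>
      calc s = a * (s * g) * b := hs
        _ = a * (s * (g * b)) := by simp only [mul_assoc]
        _ = a * (a ^ k * s * (g * b) ^ k * (g * b)) := by rw [← ih]
        _ = _ := by rw [pow_succ' a, pow_succ (g * b)]; simp only [mul_assoc]
  obtain ⟨k, hk, hid⟩ := exists_pow_idempotent (g * b)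
  have h1 : s * (g * b) ^ k = s := by
    conv_lhs => rw [key k]
    rw [mul_assoc, hid.eq, ← key k]
  obtain ⟨k, rfl⟩ := Nat.exists_eq_succ_of_ne_zero hk
  exact ⟨b * (g * b) ^ k, by
    conv_lhs => rw [← h1, pow_succ']
    simp only [mul_assoc]⟩

/-- If `p = p t` generates the same two-sided ideal as `t`, then `t ∈ M p`. -/
theorem exists_eq_mul_of_mul_eq {p t : M} (h : p * t = p) (hj : JLe t p) : ∃ y, t = y * p := by
  obtain ⟨a, b, ht⟩ := hj
  have key : ∀ k, t = (a * p) ^ k * t * b ^ k := by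
    intro k
    induction k with
    | zero => simp
    | succ k ih =>
      calc t = a * p * b := ht
        _ = a * p * t * b := by rw [mul_assoc a p t, h]
        _ = a * p * ((a * p) ^ k * t * b ^ k) * b := by rw [← ih]
        _ = _ := by rw [pow_succ' (a * p), pow_succ b]; simp only [mul_assoc]
  obtain ⟨k, hk, hid⟩ := exists_pow_idempotent (a * p)
  have h1 : (a * p) ^ k * t = t := by
    conv_lhs => rw [key k]
    rw [← mul_assoc, ← mul_assoc, hid.eq, ← key k]
  obtain ⟨k, rfl⟩ := Nat.exists_eq_succ_of_ne_zero hk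
  exact ⟨(a * p) ^ k * a, by
    conv_lhs => rw [← h1, pow_succ]
    simp only [mul_assoc, h]⟩

/-- Writing `t = y p` gives `t t = y (p t) = y p = t`. -/
theorem isIdempotentElem_of_mul_eq {p t : M} (h : p * t = p) (hj : JLe t p) :
    IsIdempotentElem t := by
  obtain ⟨y, hy⟩ := exists_eq_mul_of_mul_eq h hj
  rw [IsIdempotentElem]
  nth_rewrite 1 [hy]
  rw [mul_assoc, h, ← hy]

/-- With `t = s g = y p` and `t' = s g'`, one has `t t' = y p t' = y p = t`. Since `s` lies in `t M`
and `t` is idempotent, `t s = s`, whence also `t t' = t'`. This makes the factors between equally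
labelled cuts all have one idempotent value. -/
theorem eq_of_mul_eq_of_same_head {p s g g' : M} (h : p * (s * g) = p) (h' : p * (s * g') = p)
    (hj : JLe (s * g) p) (hs : JLe s (s * g)) : s * g = s * g' := by
  obtain ⟨y, hy⟩ := exists_eq_mul_of_mul_eq h hj
  obtain ⟨q, hq⟩ := exists_eq_mul_of_jLe hs
  have hid := isIdempotentElem_of_mul_eq h hj
  have h1 : s * g * (s * g') = s * g := by
    nth_rewrite 1 [hy]
    rw [mul_assoc, h', ← hy]
  have h2 : s * g * (s * g') = s * g' := by
    have : s * g * s = s := by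
      nth_rewrite 2 [hq]
      rw [← mul_assoc, hid.eq, ← hq]
    rw [← mul_assoc, this]
  rw [← h1, h2]

end JOrder

/-- Consistency of the stabilisation with both factors equal to `e`. -/
theorem sharp_eq_mul_sharp_mul {M : Type*} [StabilisationMonoid M]
    (e : {e : M // IsIdempotentElem e}) : (sharp e : M) = e * sharp e * e := by
  have := StabilisationMonoid.sharp_consistent (e : M) e
    (by rw [e.2.eq]; exact e.2) (by rw [e.2.eq]; exact e.2)
  have h2 : (⟨(e : M) * e, by rw [e.2.eq]; exact e.2⟩ : {e : M // IsIdempotentElem e}) = e :=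
    Subtype.ext e.2
  rwa [h2] at this

/-- As `sharp e = e * sharp e`, stability of finite monoids puts `e` in `sharp e * M`, so the
idempotent `sharp e` fixes `e` on the left; but `sharp e * e = sharp e`. Thus a stabilisation either
changes nothing or strictly lowers the rank. -/
theorem sharp_eq_self_of_jLe {M : Type*} [StabilisationMonoid M]
    (e : {e : M // IsIdempotentElem e}) (h : JLe (e : M) (sharp e : M)) : (sharp e : M) = e := by
  have : Finite M := StabilisationMonoid.finite
  have hc := sharp_eq_mul_sharp_mul e
  have h1 : (sharp e : M) = e * (sharp e : M) := by
    rw [hc, ← mul_assoc, ← mul_assoc, e.2.eq]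
  have h2 : (sharp e : M) * e = sharp e := by
    rw [hc, mul_assoc, e.2.eq]
  rw [h1] at h
  obtain ⟨q, hq⟩ := exists_eq_mul_of_jLe h
  rw [← h1] at hq
  have h3 : (sharp e : M) * e = e := by
    calc (sharp e : M) * e = sharp e * (sharp e * q) := by rw [← hq]
      _ = e := by rw [← mul_assoc, (sharp e).2.eq, ← hq]
  rw [← h2, h3]

/-! ### Existence of computations of bounded height -/

/-- Exact computations. -/
abbrev ExactComp {M : Type*} [StabilisationMonoid M] (n p : ℕ) (u : List M) (a : M) : Prop :=
  HasComp (fun x y => x = y) n p u a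

/-! ### Cuts of a word, labelled by the product before them and the letter after them. -/

section Labels

variable {M : Type*} [Monoid M]

/-- Read after a prefix of product `P`, every inner cut of the word `u` has its label in `Λ`, the
label of a cut consisting of the product of what precedes and of the next letter. -/
def LabelsIn (Λ : Finset (M × M)) : M → List M → Prop
  | _, [] => True
  | _, [_] => True
  | P, a :: b :: u => (P * a, b) ∈ Λ ∧ LabelsIn Λ (P * a) (b :: u)

theorem labelsIn_of_forall_mem {Λ : Finset (M × M)} (hΛ : ∀ x, x ∈ Λ) :
    ∀ (P : M) (u : List M), LabelsIn Λ P u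
  | _, [] => trivial
  | _, [_] => trivial
  | P, a :: b :: u => ⟨hΛ _, labelsIn_of_forall_mem hΛ (P * a) (b :: u)⟩

/-- Decomposition of a word at all the cuts with label `(p, s)`. -/
theorem LabelsIn.split [DecidableEq M] {Λ : Finset (M × M)} (p s : M) :
    ∀ (u v : List M), u ≠ [] → LabelsIn Λ v.prod u →
      ∃ (y : List M) (zs : List (List M)), u = y ++ zs.flatten ∧ y ≠ [] ∧
        LabelsIn (Λ.erase (p, s)) v.prod y ∧ (zs ≠ [] → v.prod * y.prod = p) ∧
        (∀ z ∈ zs, ∃ v' z' : List M, z = s :: z' ∧ v'.prod = p ∧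
          LabelsIn (Λ.erase (p, s)) p z ∧ v' ++ z <+: v ++ u) ∧
        ∀ z ∈ zs.dropLast, p * z.prod = p
  | [], _, h, _ => absurd rfl h
  | [a], _, _, _ => ⟨[a], [], by simp, by simp, trivial, by simp, by simp, by simp⟩
  | a :: b :: u, v, _, hu => by
    have hP : (v ++ [a]).prod = v.prod * a := by simp
    obtain ⟨y, zs, hbu, hy, hLy, hpy, hzs, hdrop⟩ :=
      LabelsIn.split p s (b :: u) (v ++ [a]) (by simp) (by rw [hP]; exact hu.2)
    rw [hP] at hLy hpy
    have hv : v ++ [a] ++ (b :: u) = v ++ (a :: b :: u) := by simp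
    rw [hv] at hzs
    obtain ⟨y', rfl⟩ : ∃ y', y = b :: y' := by
      cases y with
      | nil => exact absurd rfl hy
      | cons c y' =>
        have : b = c := by simpa using congrArg List.head? hbu
        exact ⟨y', by rw [this]⟩
    by_cases hlab : (v.prod * a, b) = (p, s)
    · obtain ⟨h1, rfl⟩ := Prod.mk.inj hlab
      refine ⟨[a], (b :: y') :: zs, by simp [hbu], by simp, trivial, fun _ => by simpa using h1,
        ?_, ?_⟩
      · rintro z hz
        rcases List.mem_cons.1 hz with rfl | hz
        · refine ⟨v ++ [a], y', rfl, by rw [hP, h1], by rwa [h1] at hLy, ?_⟩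
          rw [← hv, hbu, List.prefix_append_right_inj]
          exact List.prefix_append _ _
        · exact hzs z hz
      · intro z hz
        cases zs with
        | nil => simp at hz
        | cons z' zs =>
          rw [List.dropLast_cons_of_ne_nil (by simp)] at hz
          rcases List.mem_cons.1 hz with rfl | hz
          · have := hpy (by simp)
            rwa [h1] at this
          · exact hdrop z hz
    · refine ⟨a :: b :: y', zs, by simpa using hbu, by simp,
        ⟨Finset.mem_erase.2 ⟨hlab, hu.1⟩, hLy⟩, fun h => ?_, hzs, hdrop⟩
      rw [← hpy h, List.prod_cons, mul_assoc]

end Labels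

/-! ### Factorisation by induction on the rank. -/

section Existence

variable {M : Type*} [StabilisationMonoid M] {n k H : ℕ} {W : List M}

theorem jRank_prod_of_infix [Finite M] (hW : k < jRank W.prod) (hl : ∀ x ∈ W, jRank x ≤ k + 1)
    {t : List M} (ht : t ≠ []) (hi : t <:+: W) : jRank t.prod = k + 1 := by
  apply le_antisymm
  · cases t with
    | nil => exact absurd rfl ht
    | cons a t =>
      rw [List.prod_cons]
      exact (jRank_mono (JLe.mul_right _ _)).trans (hl a (hi.subset (by simp)))
  · obtain ⟨a, b, rfl⟩ := hi
    rw [List.prod_append, List.prod_append] at hW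
    exact hW.trans_le (jRank_mono ⟨_, _, rfl⟩)

/-- Induction on the number of labels that may occur. The word is split at all cuts with one label
`(p, s)`; inside the pieces this label no longer occurs. Each middle piece starts with `s` and fixes
`p` on the right, and all ranks equal `k + 1`, so the middle pieces share one idempotent value and
can be grouped under a single node. -/
theorem exactComp_of_labelsIn [Finite M] (hW : k < jRank W.prod) (hl : ∀ x ∈ W, jRank x ≤ k + 1)
    (hdrop : ∀ v, v ≠ [] → v <+: W → ∀ a, ExactComp n (H + 1) v a → k < jRank a)
    (hpre : ∀ v, v ≠ [] → v <+: W → v ≠ W → ExactComp n H v v.prod) :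
    ∀ (j : ℕ) (Λ : Finset (M × M)), Λ.card = j → 3 * j ≤ H → ∀ v u : List M, u ≠ [] →
      v ++ u <+: W → LabelsIn Λ v.prod u → ExactComp n (3 * j) u u.prod := by
  classical
  intro j
  induction j with
  | zero =>
    intro Λ hΛ _ v u hu _ hL
    rw [Finset.card_eq_zero] at hΛ
    subst hΛ
    match u, hu, hL with
    | [a], _, _ => exact .leaf _ _ _ (by simp)
    | a :: b :: u, _, hL => exact absurd hL.1 (by simp)
  | succ j ih =>
    intro Λ hΛ hj v u hu hvu hL
    obtain ⟨⟨p, s⟩, hps⟩ : Λ.Nonempty := Finset.card_pos.1 (by omega)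
    obtain ⟨y, zs, rfl, hy, hLy, hpy, hzs, hmid⟩ := hL.split p s u v hu
    have hcard : (Λ.erase (p, s)).card = j := by rw [Finset.card_erase_of_mem hps, hΛ]; rfl
    have hvy : v ++ y <+: W :=
      List.IsPrefix.trans (by rw [← List.append_assoc]; exact List.prefix_append _ _) hvu
    have hcy : ExactComp n (3 * j) y y.prod := ih _ hcard (by omega) v y hy hvy hLy
    have hcz : ∀ z ∈ zs, ExactComp n (3 * j) z z.prod := by
      intro z hz
      obtain ⟨v', z', h1, h2, h3, h4⟩ := hzs z hz
      exact ih _ hcard (by omega) v' z (by simp [h1]) (h4.trans hvu) (by rwa [h2])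
    rcases List.eq_nil_or_concat zs with rfl | ⟨mid, zl, hzl⟩
    · simpa using hcy.height_mono (by omega)
    rw [List.concat_eq_append] at hzl
    subst hzl
    rw [List.dropLast_concat] at hmid
    have hczl : ExactComp n (3 * j) zl zl.prod := hcz zl (by simp)
    have hp : (v ++ y).prod = p := by rw [List.prod_append]; exact hpy (by simp)
    have hrp : jRank p = k + 1 := by
      rw [← hp]
      exact jRank_prod_of_infix hW hl (by simp [hy]) hvy.isInfix
    have hz : ∀ z ∈ mid, ∃ z', z = s :: z' ∧ JLe z.prod p ∧ JLe s z.prod := by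
      intro z hz
      obtain ⟨v', z', h1, -, -, h4⟩ := hzs z (by simp [hz])
      have hi : z <:+: W := (List.suffix_append v' z).isInfix.trans (h4.trans hvu).isInfix
      have hr : jRank z.prod = k + 1 := jRank_prod_of_infix hW hl (by simp [h1]) hi
      refine ⟨z', h1, ?_, ?_⟩
      · refine JLe.of_jRank_le ?_ (by omega)
        conv_lhs => rw [← hmid z hz]
        exact JLe.mul_left _ _
      · refine JLe.of_jRank_le ?_ ?_
        · rw [h1, List.prod_cons]; exact JLe.mul_right _ _
        · rw [hr]; exact hl s (hi.subset (by simp [h1]))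
    have hcmid : mid ≠ [] → ExactComp n (3 * j + 1) mid.flatten mid.flatten.prod := by
      intro hne
      obtain ⟨z₀, mid', hmid'⟩ := List.exists_cons_of_ne_nil hne
      have hz₀ : z₀ ∈ mid := by simp [hmid']
      have hid : IsIdempotentElem z₀.prod := by
        obtain ⟨_, _, h, _⟩ := hz z₀ hz₀
        exact isIdempotentElem_of_mul_eq (hmid z₀ hz₀) h
      have heq : ∀ z ∈ mid, z.prod = z₀.prod := by
        intro z hzm
        obtain ⟨g, hg, -, -⟩ := hz z hzm
        obtain ⟨g₀, hg₀, h1, h2⟩ := hz z₀ hz₀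
        have e1 := hmid z hzm
        have e0 := hmid z₀ hz₀
        rw [hg, List.prod_cons] at e1
        rw [hg₀, List.prod_cons] at e0 h1 h2
        rw [hg, hg₀, List.prod_cons, List.prod_cons]
        exact (eq_of_mul_eq_of_same_head e0 e1 h1 h2).symm
      have hprod : mid.flatten.prod = z₀.prod := by
        have : mid.map List.prod = List.replicate mid.length z₀.prod := by
          rw [List.eq_replicate_iff]
          simpa using heq
        rw [List.prod_flatten, this, List.prod_replicate]
        exact pow_eq_of_idempotent hid (by simpa using hne)
      have hc : ∀ z ∈ mid, ExactComp n (3 * j) z z₀.prod := by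
        intro z hzm
        rw [← heq z hzm]
        exact hcz z (by simp [hzm])
      rw [hprod]
      by_cases hlen : mid.length ≤ 1
      · have : mid' = [] := by
          rw [hmid', List.length_cons] at hlen
          exact List.length_eq_zero_iff.1 (by omega)
        subst this
        rw [hmid']
        simpa using (hc z₀ hz₀).height_mono (Nat.le_succ _)
      by_cases hn : mid.length ≤ n
      · exact .idempotent _ _ ⟨_, hid⟩ _ (by omega) hn hc rfl
      have hst : ExactComp n (3 * j + 1) mid.flatten (sharp ⟨z₀.prod, hid⟩ : M) :=
        .stabilisation _ _ ⟨_, hid⟩ _ (by omega) hc rfl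
      by_cases hJ : JLe z₀.prod (sharp ⟨z₀.prod, hid⟩ : M)
      · rwa [sharp_eq_self_of_jLe _ hJ] at hst
      -- A stabilisation that changes the value lowers its rank to at most `k`. Joined to a
      -- computation of `v ++ y`, it would give a prefix of `W` a value of rank at most `k`, against
      -- `hdrop`.
      exfalso
      have hpm : v ++ y ++ mid.flatten <+: W := by
        refine List.IsPrefix.trans ?_ hvu
        simp only [List.flatten_append, ← List.append_assoc]
        exact List.prefix_append _ _
      have hcvy : ExactComp n H (v ++ y) (v ++ y).prod := by
        refine hpre _ (by simp [hy]) hvy fun h => ?_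
        have h1 := hpm.length_le
        rw [← h, List.length_append, hmid', List.flatten_cons, List.length_append] at h1
        obtain ⟨z', hz', -⟩ := hz z₀ hz₀
        rw [hz', List.cons_append, List.length_cons] at h1
        omega
      have hd := hdrop _ (by simp [hy]) hpm _
        (.binary H _ _ _ _ _ hcvy (hst.height_mono (by omega)) rfl)
      refine hJ (JLe.of_jRank_le (y := z₀.prod) (x := (sharp ⟨z₀.prod, hid⟩ : M)) ?_ ?_)
      · exact ⟨z₀.prod * sharp ⟨z₀.prod, hid⟩, 1, by
          rw [mul_one]; exact sharp_eq_mul_sharp_mul ⟨z₀.prod, hid⟩⟩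
      · obtain ⟨_, _, h, _⟩ := hz z₀ hz₀
        have h1 := jRank_mono h
        have h2 := jRank_mono (JLe.mul_left (v ++ y).prod (sharp ⟨z₀.prod, hid⟩ : M))
        omega
    by_cases hne : mid = []
    · subst hne
      have h1 := HasComp.binary (r := fun x y => x = y) (3 * j) _ _ _ _ _ hcy hczl rfl
      simpa [List.prod_append] using h1.height_mono (by omega : _ ≤ 3 * (j + 1))
    -- Three levels per label: the node over the middle pieces, then one binary node for the last
    -- piece and one for the first.
    · have h1 := HasComp.binary (r := fun x y => x = y) (3 * j + 1) _ _ _ _ _ (hcmid hne)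
        (hczl.height_mono (by omega)) rfl
      have h2 := HasComp.binary (r := fun x y => x = y) (3 * j + 2) _ _ _ _ _
        (hcy.height_mono (by omega)) h1 rfl
      simpa [List.prod_append, Nat.mul_succ] using h2

/-- By induction on the length: if no prefix drops to rank `k`, all proper prefixes are evaluated
exactly to their product. Either the whole product keeps rank `k + 1` and the label argument
applies, with all of `M × M` as labels, or appending the last letter is itself a drop, at the cost
of one binary node. -/
theorem exists_drop_or_exactComp [Finite M] (hH : 3 * Nat.card (M × M) ≤ H) (n k : ℕ) :
    ∀ (l : ℕ) (W : List M), W.length = l → W ≠ [] → (∀ x ∈ W, jRank x ≤ k + 1) →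
      (∃ v, v ≠ [] ∧ v <+: W ∧ ∃ a, ExactComp n (H + 1) v a ∧ jRank a ≤ k) ∨
        ExactComp n H W W.prod := by
  classical
  have := Fintype.ofFinite M
  intro l
  induction l using Nat.strong_induction_on with
  | h l ih =>
    intro W hWl hne hl
    by_cases hd : ∃ v, v ≠ [] ∧ v <+: W ∧ ∃ a, ExactComp n (H + 1) v a ∧ jRank a ≤ k
    · exact Or.inl hd
    have hpre : ∀ v, v ≠ [] → v <+: W → v ≠ W → ExactComp n H v v.prod := by
      intro v hv hvW hvne
      have hlt : v.length < W.length :=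
        lt_of_le_of_ne hvW.length_le fun h => hvne (hvW.eq_of_length h)
      rcases ih v.length (hWl ▸ hlt) v rfl hv (fun x hx => hl x (hvW.subset hx)) with h | h
      · obtain ⟨t, ht, htv, a, h⟩ := h
        exact absurd ⟨t, ht, htv.trans hvW, a, h⟩ hd
      · exact h
    by_cases hr : k < jRank W.prod
    · right
      refine (exactComp_of_labelsIn hr hl (fun v hv hvW a ha => ?_) hpre _ Finset.univ rfl ?_ [] W
        hne (by simp) (labelsIn_of_forall_mem (by simp) _ _)).height_mono ?_
      · by_contra hlt
        exact hd ⟨v, hv, hvW, a, ha, by omega⟩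
      all_goals rwa [Finset.card_univ, ← Nat.card_eq_fintype_card]
    · left
      rcases List.eq_nil_or_concat W with rfl | ⟨s, a, rfl⟩
      · exact absurd rfl hne
      rw [List.concat_eq_append] at *
      refine ⟨_, hne, List.prefix_rfl, (s ++ [a]).prod, ?_, by omega⟩
      by_cases hs : s = []
      · subst hs
        exact .leaf _ _ _ (by simp)
      · exact .binary _ _ _ s.prod a _ (hpre s hs (List.prefix_append _ _) (by simp))
          (.leaf _ _ _ rfl) (by simp)

/-- Prefixes of dropped rank are cut off repeatedly. The word of their values has letters of rank at
most `k`, so the induction hypothesis applies to it and the pieces are substituted for its letters.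
A remainder without drop is merged with the last piece, which accounts for `H + 2`. -/
theorem exists_exactComp_of_jRank_le [Finite M] (hH : 3 * Nat.card (M × M) ≤ H) (n : ℕ) :
    ∀ (k : ℕ) (W : List M), W ≠ [] → (∀ x ∈ W, jRank x ≤ k) →
      ∃ a, ExactComp n (k * (H + 2)) W a := by
  intro k
  induction k with
  | zero =>
    intro W hne hl
    obtain ⟨a, W, rfl⟩ := List.exists_cons_of_ne_nil hne
    have := jRank_pos a
    have := hl a (by simp)
    omega
  | succ k ih =>
    have key : ∀ (l : ℕ) (W : List M), W.length = l → W ≠ [] → (∀ x ∈ W, jRank x ≤ k + 1) →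
        (∃ ps : List (M × List M), ps ≠ [] ∧ W = ps.flatMap Prod.snd ∧
          ∀ x ∈ ps, ExactComp n (H + 2) x.2 x.1 ∧ jRank x.1 ≤ k) ∨
        ∃ a, ExactComp n (H + 1) W a := by
      intro l
      induction l using Nat.strong_induction_on with
      | h l ihl =>
        intro W hWl hne hl
        rcases exists_drop_or_exactComp hH n k _ W rfl hne hl with ⟨v, hv, ⟨t, rfl⟩, a, ha, hak⟩ | h
        · by_cases ht : t = []
          · subst ht
            exact Or.inl ⟨[(a, v)], by simp, by simp,
              by simpa using ⟨ha.height_mono (by omega), hak⟩⟩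
          have hlt : t.length < l := by
            rw [← hWl, List.length_append]
            have := List.length_pos_of_ne_nil hv
            omega
          rcases ihl _ hlt t rfl ht fun x hx => hl x (by simp [hx]) with ⟨ps, hps, rfl, h⟩ | ⟨b, hb⟩
          · refine Or.inl ⟨(a, v) :: ps, by simp, by simp, ?_⟩
            intro x hx
            rcases List.mem_cons.1 hx with rfl | hx
            · exact ⟨ha.height_mono (by omega), hak⟩
            · exact h x hx
          · refine Or.inl ⟨[(a * b, v ++ t)], by simp, by simp, ?_⟩
            simp only [List.mem_singleton, forall_eq]
            exact ⟨.binary _ _ _ _ _ _ ha hb rfl, (jRank_mono (JLe.mul_right a b)).trans hak⟩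
        · exact Or.inr ⟨_, h.height_mono (by omega)⟩
    intro W hne hl
    rcases key _ W rfl hne hl with ⟨ps, hps, rfl, h⟩ | ⟨a, ha⟩
    · obtain ⟨a, ha⟩ := ih (ps.map Prod.fst) (by simpa using hps) (by
        intro x hx
        obtain ⟨y, hy, rfl⟩ := List.mem_map.1 hx
        exact (h y hy).2)
      refine ⟨a, ?_⟩
      rw [Nat.succ_mul]
      exact HasComp.bind (r := fun x y => x = y) (fun _ _ _ => Eq.trans) ha ps rfl
        fun x hx => (h x hx).1
    · exact ⟨a, ha.height_mono (by nlinarith)⟩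

/-- A height that suffices for computations in a stabilisation monoid with `m` elements. -/
def compBound (m : ℕ) : ℕ := m * (3 * (m * m) + 2)

theorem exists_exactComp (n : ℕ) (W : List M) (hne : W ≠ []) :
    ∃ a, ExactComp n (compBound (Nat.card M)) W a := by
  have : Finite M := StabilisationMonoid.finite
  exact exists_exactComp_of_jRank_le (by rw [Nat.card_prod]) n _ W hne
    fun x _ => jRank_le_card x

end Existence

/-! ### The stabilisation monoid of upward closed sets -/

/-- Upward closed subsets of `M`, ordered by reverse inclusion. -/
@[ext]
structure UpSet (M : Type*) [LE M] where
  carrier : Set M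
  upper : ∀ x y, x ≤ y → x ∈ carrier → y ∈ carrier

namespace UpSet

instance {M : Type*} [LE M] : Membership M (UpSet M) := ⟨fun X x => x ∈ X.carrier⟩

theorem ext_mem {M : Type*} [LE M] {X Y : UpSet M} (h : ∀ x, x ∈ X ↔ x ∈ Y) : X = Y :=
  UpSet.ext (Set.ext h)

theorem carrier_injective {M : Type*} [LE M] :
    Function.Injective (UpSet.carrier : UpSet M → Set M) := fun _ _ => UpSet.ext

instance {M : Type*} [LE M] : PartialOrder (UpSet M) where
  le X Y := ∀ x ∈ Y, x ∈ X
  le_refl _ _ h := h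
  le_trans _ _ _ h₁ h₂ x hx := h₁ x (h₂ x hx)
  le_antisymm _ _ h₁ h₂ := ext_mem fun x => ⟨h₂ x, h₁ x⟩

variable {M : Type*} [StabilisationMonoid M]

theorem mem_of_le {X : UpSet M} {x y : M} (hx : x ∈ X) (h : x ≤ y) : y ∈ X := X.upper x y h hx

instance : One (UpSet M) := ⟨⟨{x | 1 ≤ x}, fun _ _ h hx => le_trans hx h⟩⟩

instance : Mul (UpSet M) :=
  ⟨fun X Y => ⟨{x | ∃ a ∈ X, ∃ b ∈ Y, a * b ≤ x}, by
    rintro x y h ⟨a, ha, b, hb, hx⟩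
    exact ⟨a, ha, b, hb, hx.trans h⟩⟩⟩

theorem mem_one {x : M} : x ∈ (1 : UpSet M) ↔ 1 ≤ x := Iff.rfl

theorem mul_mem_mul {X Y : UpSet M} {x y : M} (hx : x ∈ X) (hy : y ∈ Y) : x * y ∈ X * Y :=
  ⟨x, hx, y, hy, le_rfl⟩

theorem mem_mul_mul {X Y Z : UpSet M} {x : M} :
    x ∈ X * Y * Z ↔ ∃ a ∈ X, ∃ b ∈ Y, ∃ c ∈ Z, a * b * c ≤ x := by
  constructor
  · rintro ⟨y, ⟨a, ha, b, hb, hy⟩, c, hc, hx⟩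
    exact ⟨a, ha, b, hb, c, hc, (StabilisationMonoid.mul_mono _ _ _ _ hy le_rfl).trans hx⟩
  · rintro ⟨a, ha, b, hb, c, hc, hx⟩
    exact ⟨a * b, mul_mem_mul ha hb, c, hc, hx⟩

instance : Monoid (UpSet M) where
  mul_assoc X Y Z := by
    refine ext_mem fun x => mem_mul_mul.trans ⟨?_, ?_⟩
    · rintro ⟨a, ha, b, hb, c, hc, hx⟩
      exact ⟨a, ha, b * c, mul_mem_mul hb hc, by rwa [← mul_assoc]⟩
    · rintro ⟨a, ha, y, ⟨b, hb, c, hc, hy⟩, hx⟩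
      refine ⟨a, ha, b, hb, c, hc, le_trans ?_ hx⟩
      rw [mul_assoc]
      exact StabilisationMonoid.mul_mono _ _ _ _ le_rfl hy
  one_mul X := by
    refine ext_mem fun x => ⟨?_, fun hx => ⟨1, le_rfl, x, hx, by simp⟩⟩
    rintro ⟨a, ha, b, hb, hx⟩
    refine mem_of_le hb (le_trans ?_ hx)
    have := StabilisationMonoid.mul_mono 1 a b b ha le_rfl
    rwa [one_mul] at this
  mul_one X := by
    refine ext_mem fun x => ⟨?_, fun hx => ⟨x, hx, 1, le_rfl, by simp⟩⟩
    rintro ⟨a, ha, b, hb, hx⟩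
    refine mem_of_le ha (le_trans ?_ hx)
    have := StabilisationMonoid.mul_mono a a 1 b le_rfl hb
    rwa [mul_one] at this

/-- The elements generated by `E` under the product and the stabilisation, up to `≤`. -/
inductive Gen (E : UpSet M) : M → Prop
  | base (x : M) (h : x ∈ E) : Gen E x
  | up (x y : M) (h : Gen E x) (hxy : x ≤ y) : Gen E y
  | mul (x y : M) (hx : Gen E x) (hy : Gen E y) : Gen E (x * y)
  | sharp (e : {e : M // IsIdempotentElem e}) (h : Gen E e) : Gen E (sharp e : M)

/-- The upward closed set generated by `E` under the product and the stabilisation. -/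
def gen (E : UpSet M) : UpSet M := ⟨{x | Gen E x}, fun x y h hx => .up x y hx h⟩

/-- Closure under the product and the stabilisation. -/
def IsClosed (X : UpSet M) : Prop :=
  (∀ x ∈ X, ∀ y ∈ X, x * y ∈ X) ∧
    ∀ e : {e : M // IsIdempotentElem e}, (e : M) ∈ X → (sharp e : M) ∈ X

theorem isClosed_gen (E : UpSet M) : IsClosed (gen E) :=
  ⟨fun x hx y hy => .mul x y hx hy, fun e he => .sharp e he⟩

theorem subset_gen (E : UpSet M) {x : M} (hx : x ∈ E) : x ∈ gen E := .base x hx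

theorem gen_subset {E X : UpSet M} (hX : IsClosed X) (h : ∀ x ∈ E, x ∈ X) {x : M}
    (hx : x ∈ gen E) : x ∈ X := by
  induction hx with
  | base x hx => exact h x hx
  | up x y _ hxy ih => exact mem_of_le ih hxy
  | mul x y _ _ ih₁ ih₂ => exact hX.1 x ih₁ y ih₂
  | sharp e _ ih => exact hX.2 e ih

theorem isIdempotentElem_gen {E : UpSet M} (hE : IsIdempotentElem E) :
    IsIdempotentElem (gen E) := by
  refine ext_mem fun x => ⟨?_, fun hx => ?_⟩
  · rintro ⟨a, ha, b, hb, hx⟩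
    exact mem_of_le ((isClosed_gen E).1 a ha b hb) hx
  · induction hx with
    | base x hx =>
      rw [← hE.eq] at hx
      obtain ⟨a, ha, b, hb, hx⟩ := hx
      exact ⟨a, subset_gen E ha, b, subset_gen E hb, hx⟩
    | up x y _ hxy ih => exact mem_of_le ih hxy
    | mul x y hx hy _ _ => exact mul_mem_mul hx hy
    | sharp e h _ =>
      have := mul_mem_mul (X := gen E) (Y := gen E) (Gen.sharp e h) (Gen.sharp e h)
      rwa [(StabilisationMonoid.sharp e).2.eq] at this

/-- The idempotent `e = a x b` is written `a · (x b a x b)`. The exchanged product is `(x b a)^2`,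
which is idempotent (`x b a` itself need not be) and lies in `gen (B * A)`; consistency in `M` then
moves the stabilisation inside. -/
theorem sharp_mul_mem {A B : UpSet M} {a x b : M} (ha : a ∈ A)
    (hx : x ∈ gen (B * A)) (hb : b ∈ B) (e : {e : M // IsIdempotentElem e})
    (he : (e : M) = a * x * b) : (sharp e : M) ∈ A * gen (B * A) * B := by
  have hxba : x * (b * a) ∈ gen (B * A) :=
    (isClosed_gen _).1 _ hx _ (subset_gen _ (mul_mem_mul hb ha))
  have hee : a * x * b * (a * x * b) = a * x * b := by rw [← he, e.2.eq]
  have hid : IsIdempotentElem (x * b * (a * x * b) * a) := by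
    calc x * b * (a * x * b) * a * (x * b * (a * x * b) * a)
        = x * b * (a * x * b * (a * x * b) * (a * x * b)) * a := by simp only [mul_assoc]
      _ = x * b * (a * x * b) * a := by rw [hee, hee]
  have he' : (e : M) = a * (x * b * (a * x * b)) := by
    rw [he]
    conv_lhs => rw [← hee]
    simp only [mul_assoc]
  have h := StabilisationMonoid.sharp_consistent a (x * b * (a * x * b)) (by rw [← he']; exact e.2)
    hid
  have hs : (sharp e : M) = a * (sharp ⟨_, hid⟩ * (x * (b * a)) * x) * b := by
    have : e = ⟨a * (x * b * (a * x * b)), by rw [← he']; exact e.2⟩ := Subtype.ext he'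
    rw [this, h]
    simp only [mul_assoc]
  have hmem : x * b * (a * x * b) * a ∈ gen (B * A) := by
    have : x * b * (a * x * b) * a = x * (b * a) * (x * (b * a)) := by simp only [mul_assoc]
    rw [this]
    exact (isClosed_gen _).1 _ hxba _ hxba
  rw [hs]
  refine mul_mem_mul (mul_mem_mul ha ?_) hb
  exact (isClosed_gen _).1 _ ((isClosed_gen _).1 _ ((isClosed_gen _).2 _ hmem) _ hxba) _ hx

/-- The right-hand side contains `A * B` and is closed. For the stabilisation, an idempotent `e` in
it dominates some `a s b`; an idempotent power of `a s b` is below `e`, again has the form `a s' b`,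
and falls under `sharp_mul_mem`. -/
theorem gen_mul_subset {A B : UpSet M} (hAB : IsIdempotentElem (A * B)) {x : M}
    (hx : x ∈ gen (A * B)) :
    x ∈ A * gen (B * A) * B := by
  refine gen_subset (X := A * gen (B * A) * B) ⟨?_, ?_⟩ ?_ hx
  · intro x hx y hy
    obtain ⟨a, ha, s, hs, b, hb, hx⟩ := mem_mul_mul.1 hx
    obtain ⟨a', ha', s', hs', b', hb', hy⟩ := mem_mul_mul.1 hy
    refine mem_mul_mul.2 ⟨a, ha, s * (b * a') * s', ?_, b', hb', ?_⟩
    · exact (isClosed_gen _).1 _ ((isClosed_gen _).1 _ hs _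
        (subset_gen _ (mul_mem_mul hb ha'))) _ hs'
    · have := StabilisationMonoid.mul_mono _ _ _ _ hx hy
      simpa only [mul_assoc] using this
  · intro e he
    have : Finite M := StabilisationMonoid.finite
    obtain ⟨a, ha, s, hs, b, hb, hx⟩ := mem_mul_mul.1 he
    obtain ⟨k, hk, hid⟩ := exists_pow_idempotent (a * s * b)
    have hle : (a * s * b) ^ k ≤ e := by
      rw [← pow_eq_of_idempotent e.2 hk]
      clear hid hk
      induction k with
      | zero => simp
      | succ k ih =>
        rw [pow_succ, pow_succ]
        exact StabilisationMonoid.mul_mono _ _ _ _ ih hx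
    obtain ⟨k, rfl⟩ := Nat.exists_eq_succ_of_ne_zero hk
    have hform : ∀ k : ℕ, ∃ s' ∈ gen (B * A), (a * s * b) ^ (k + 1) = a * s' * b := by
      intro k
      induction k with
      | zero => exact ⟨s, hs, by simp⟩
      | succ k ih =>
        obtain ⟨s', hs', h⟩ := ih
        refine ⟨s' * (b * a) * s, (isClosed_gen _).1 _ ((isClosed_gen _).1 _ hs' _
          (subset_gen _ (mul_mem_mul hb ha))) _ hs, ?_⟩
        rw [pow_succ, h]
        simp only [mul_assoc]
    obtain ⟨s', hs', h⟩ := hform k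
    exact mem_of_le (sharp_mul_mem ha hs' hb ⟨_, hid⟩ h)
      (StabilisationMonoid.sharp_mono ⟨_, hid⟩ e hle)
  · intro x hx
    rw [← hAB.eq] at hx
    obtain ⟨y, ⟨a, ha, b, hb, hy⟩, y', ⟨a', ha', b', hb', hy'⟩, hx⟩ := hx
    refine mem_mul_mul.2 ⟨a, ha, b * a', subset_gen _ (mul_mem_mul hb ha'), b', hb', ?_⟩
    refine le_trans ?_ hx
    have := StabilisationMonoid.mul_mono _ _ _ _ hy hy'
    simpa only [mul_assoc] using this

/-- For the reverse inclusion, the previous lemma with the roles exchanged places `A * gen (B * A) *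
B` inside `A * B * gen (A * B) * A * B`. -/
theorem gen_mul {A B : UpSet M} (hAB : IsIdempotentElem (A * B)) (hBA : IsIdempotentElem (B * A)) :
    gen (A * B) = A * gen (B * A) * B := by
  refine ext_mem fun x => ⟨gen_mul_subset hAB, fun hx => ?_⟩
  obtain ⟨a, ha, s, hs, b, hb, hx⟩ := mem_mul_mul.1 hx
  obtain ⟨b', hb', t, ht, a', ha', hs⟩ := mem_mul_mul.1 (gen_mul_subset hBA hs)
  have h1 : a * b' * t * (a' * b) ∈ gen (A * B) :=
    (isClosed_gen _).1 _ ((isClosed_gen _).1 _ (subset_gen _ (mul_mem_mul ha hb')) _ ht) _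
      (subset_gen _ (mul_mem_mul ha' hb))
  refine mem_of_le h1 (le_trans ?_ hx)
  have := StabilisationMonoid.mul_mono _ _ _ _
    (StabilisationMonoid.mul_mono _ _ _ _ (le_refl a) hs) (le_refl b)
  simpa only [mul_assoc] using this

instance : StabilisationMonoid (UpSet M) where
  finite := by
    have : Finite M := StabilisationMonoid.finite
    exact Finite.of_injective _ carrier_injective
  mul_mono := by
    rintro X X' Y Y' hX hY x ⟨a, ha, b, hb, hx⟩
    exact ⟨a, hX a ha, b, hY b hb, hx⟩
  sharp E := ⟨gen E, isIdempotentElem_gen E.2⟩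
  sharp_mono E F h x hx :=
    gen_subset (isClosed_gen _) (fun y hy => subset_gen _ (h y hy)) hx
  sharp_consistent _ _ hAB hBA := gen_mul hAB hBA
  sharp_le E x hx := subset_gen _ hx
  sharp_sharp E := by
    refine Subtype.ext (ext_mem fun x => ⟨fun hx => ?_, fun hx => subset_gen _ hx⟩)
    exact gen_subset (isClosed_gen _) (fun y hy => hy) hx
  sharp_one := by
    refine ext_mem fun x => ⟨fun hx => ?_, fun hx => subset_gen _ hx⟩
    -- The elements above `1` are already closed, because `sharp` is monotone and fixes `1`.
    refine gen_subset (X := 1) ⟨fun x hx y hy => ?_, fun e he => ?_⟩ (fun y hy => hy) hx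
    · have := StabilisationMonoid.mul_mono _ _ _ _ (mem_one.1 hx) (mem_one.1 hy)
      rwa [mul_one] at this
    · have := StabilisationMonoid.sharp_mono ⟨1, IsIdempotentElem.one⟩ e (mem_one.1 he)
      rwa [StabilisationMonoid.sharp_one] at this

end UpSet

/-! ### Lifting computations from upward closed sets to their elements -/

section Lift

variable {M : Type*} [StabilisationMonoid M]

theorem ExactComp.mem_of_isClosed {S : UpSet M} (hS : S.IsClosed) {n p : ℕ} {u : List M} {a : M}
    (h : ExactComp n p u a) (hu : ∀ x ∈ u, x ∈ S) : a ∈ S := by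
  induction h with
  | leaf p a v hv => exact hv ▸ hu a (by simp)
  | binary p u₁ u₂ x y v h₁ h₂ hv ih₁ ih₂ =>
    rw [hv]
    exact hS.1 _ (ih₁ fun x hx => hu x (by simp [hx])) _ (ih₂ fun x hx => hu x (by simp [hx]))
  | idempotent p us e v h2 hn h hv ih =>
    rw [hv]
    obtain ⟨u, us, rfl⟩ := List.exists_cons_of_length_pos (by omega : 0 < us.length)
    exact ih u (by simp) fun x hx => hu x (by simp [hx])
  | stabilisation p us e v hn h hv ih =>
    rw [hv]
    obtain ⟨u, us, rfl⟩ := List.exists_cons_of_length_pos (by omega : 0 < us.length)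
    exact hS.2 e (ih u (by simp) fun x hx => hu x (by simp [hx]))

theorem length_le_length_flatten {α : Type*} {us : List (List α)} (h : ∀ u ∈ us, u ≠ []) :
    us.length ≤ us.flatten.length := by
  induction us with
  | nil => simp
  | cons u us ih =>
    have h1 := List.length_pos_of_ne_nil (h u (by simp))
    have h2 := ih fun u hu => h u (by simp [hu])
    simp only [List.length_cons, List.flatten_cons, List.length_append]
    omega

/-- A stabilisation node covers more than `n` letters, so none occurs over a word this short, and
closure under product is enough. -/
theorem ExactComp.mem_of_length_le {S : UpSet M} (hS : ∀ x ∈ S, ∀ y ∈ S, x * y ∈ S) {n p : ℕ}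
    {u : List M} {a : M} (h : ExactComp n p u a) (hu : ∀ x ∈ u, x ∈ S) (hn : u.length ≤ n) :
    a ∈ S := by
  induction h with
  | leaf p a v hv => exact hv ▸ hu a (by simp)
  | binary p u₁ u₂ x y v h₁ h₂ hv ih₁ ih₂ =>
    rw [hv]
    rw [List.length_append] at hn
    exact hS _ (ih₁ (fun x hx => hu x (by simp [hx])) (by omega)) _
      (ih₂ (fun x hx => hu x (by simp [hx])) (by omega))
  | idempotent p us e v h2 _ h hv ih =>
    rw [hv]
    obtain ⟨u, us, rfl⟩ := List.exists_cons_of_length_pos (by omega : 0 < us.length)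
    rw [List.flatten_cons, List.length_append] at hn
    exact ih u (by simp) (fun x hx => hu x (by simp [hx])) (by omega)
  | stabilisation p us e v hlt h hv ih =>
    have := length_le_length_flatten fun u hu => (h u hu).ne_nil
    omega

theorem exists_pairs_of_forall₂_flatten {n q : ℕ} {E : UpSet M} :
    ∀ (us : List (List (UpSet M))),
      (∀ u ∈ us, ∀ xs, List.Forall₂ (fun (x : M) X => x ∈ X) xs u →
        ∃ x ∈ E, ExactComp n q xs x) →
      ∀ xs, List.Forall₂ (fun (x : M) X => x ∈ X) xs us.flatten →
        ∃ ps : List (M × List M), ps.length = us.length ∧ ps.flatMap Prod.snd = xs ∧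
          ∀ x ∈ ps, x.1 ∈ E ∧ ExactComp n q x.2 x.1
  | [], _, xs, hxs => ⟨[], rfl, by cases hxs; rfl, by simp⟩
  | u :: us, hus, xs, hxs => by
    rw [List.flatten_cons] at hxs
    obtain ⟨x, hx, hc⟩ := hus u (by simp) _ (List.forall₂_take_append _ _ _ hxs)
    obtain ⟨ps, h1, h2, h3⟩ := exists_pairs_of_forall₂_flatten us
      (fun u hu => hus u (by simp [hu])) _ (List.forall₂_drop_append _ _ _ hxs)
    refine ⟨(x, _) :: ps, by simp [h1],
      by rw [List.flatMap_cons, h2]; exact List.take_append_drop _ _, ?_⟩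
    intro y hy
    rcases List.mem_cons.1 hy with rfl | hy
    · exact ⟨hx, hc⟩
    · exact h3 y hy

/-- An under-computation over upward closed sets induces exact computations, with the same
threshold, for all the choices of elements in the letters. -/
theorem exists_exactComp_of_under {n p : ℕ} {w : List (UpSet M)} {X : UpSet M}
    (h : HasComp (fun x y => x ≤ y) n p w X) :
    ∀ xs, List.Forall₂ (fun (x : M) X => x ∈ X) xs w →
      ∃ x ∈ X, ExactComp n ((compBound (Nat.card M) + 1) * p) xs x := by
  induction h with
  | leaf p a v hv =>
    intro xs hxs
    cases hxs with
    | cons h1 h2 => cases h2; exact ⟨_, hv _ h1, .leaf _ _ _ rfl⟩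
  | binary p u₁ u₂ x y v h₁ h₂ hv ih₁ ih₂ =>
    intro xs hxs
    obtain ⟨a, ha, hca⟩ := ih₁ _ (List.forall₂_take_append _ _ _ hxs)
    obtain ⟨b, hb, hcb⟩ := ih₂ _ (List.forall₂_drop_append _ _ _ hxs)
    refine ⟨a * b, hv _ (UpSet.mul_mem_mul ha hb), ?_⟩
    have := HasComp.binary (r := fun x y => x = y) _ _ _ _ _ _ hca hcb rfl
    rw [List.take_append_drop] at this
    exact this.height_mono (by nlinarith)
  | idempotent p us e v h2 hn h hv ih =>
    intro xs hxs
    obtain ⟨ps, h1, rfl, h3⟩ := exists_pairs_of_forall₂_flatten us ih xs hxs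
    have hne : ps.map Prod.fst ≠ [] := by
      intro h0
      have := congrArg List.length h0
      simp at this
      subst this
      simp at h1
      omega
    obtain ⟨y, hy⟩ := exists_exactComp n (ps.map Prod.fst) hne
    refine ⟨y, hv _ (hy.mem_of_length_le (S := e) (fun a ha b hb => ?_) ?_ (by simpa [h1] using hn)),
      ?_⟩
    · have := UpSet.mul_mem_mul ha hb
      rwa [e.2.eq] at this
    · intro x hx
      obtain ⟨q, hq, rfl⟩ := List.mem_map.1 hx
      exact (h3 q hq).1
    · exact (HasComp.bind (r := fun x y => x = y) (fun _ _ _ => Eq.trans) hy ps rfl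
        fun x hx => (h3 x hx).2).height_mono (by nlinarith)
  | stabilisation p us e v hn h hv ih =>
    intro xs hxs
    obtain ⟨ps, h1, rfl, h3⟩ := exists_pairs_of_forall₂_flatten us ih xs hxs
    have hne : ps.map Prod.fst ≠ [] := by
      intro h0
      have := congrArg List.length h0
      simp at this
      subst this
      simp at h1
      omega
    obtain ⟨y, hy⟩ := exists_exactComp n (ps.map Prod.fst) hne
    refine ⟨y, hv _ (hy.mem_of_isClosed (UpSet.isClosed_gen e) ?_), ?_⟩
    · intro x hx
      obtain ⟨q, hq, rfl⟩ := List.mem_map.1 hx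
      exact UpSet.subset_gen _ (h3 q hq).1
    · exact (HasComp.bind (r := fun x y => x = y) (fun _ _ _ => Eq.trans) hy ps rfl
        fun x hx => (h3 x hx).2).height_mono (by nlinarith)

theorem UpSet.exists_prod_le {E : UpSet M} (hE : IsIdempotentElem E) :
    ∀ (k : ℕ) (x : M), x ∈ E →
      ∃ es : List M, es.length = k + 1 ∧ (∀ e ∈ es, e ∈ E) ∧ es.prod ≤ x
  | 0, x, hx => ⟨[x], rfl, by simpa using hx, by simp⟩
  | k + 1, x, hx => by
    rw [← hE.eq] at hx
    obtain ⟨a, ha, b, hb, hx⟩ := hx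
    obtain ⟨es, h1, h2, h3⟩ := UpSet.exists_prod_le hE k b hb
    refine ⟨a :: es, by simp [h1], by simpa using ⟨ha, h2⟩, le_trans ?_ hx⟩
    rw [List.prod_cons]
    exact StabilisationMonoid.mul_mono _ _ _ _ le_rfl h3

/-- Since `E` is idempotent, `x` dominates a product of any prescribed number of elements of `E`; an
exact computation of these has a value below their product, hence below `x`. -/
theorem exists_overComp_of_mem {E : UpSet M} (hE : IsIdempotentElem E) (m : ℕ) {k : ℕ}
    (hk : k ≠ 0) {x : M} (hx : x ∈ E) :
    ∃ es : List M, es.length = k ∧ (∀ e ∈ es, e ∈ E) ∧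
      HasComp (fun x y => x ≥ y) m (compBound (Nat.card M)) es x := by
  obtain ⟨k, rfl⟩ := Nat.exists_eq_succ_of_ne_zero hk
  obtain ⟨es, h1, h2, h3⟩ := UpSet.exists_prod_le hE k x hx
  obtain ⟨a, ha⟩ := exists_exactComp m es (by rintro rfl; simp at h1)
  refine ⟨es, h1, h2, ?_⟩
  have hax : x ≥ a := (HasComp.le_prod (fun _ _ h => le_of_eq h) ha).trans h3
  exact HasComp.relax (r := fun x y => x ≥ y) (fun _ _ _ h1 h2 => le_trans h2 h1)
    (ha.imp fun _ _ h => ge_of_eq h) hax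

/-- Induction on the generation of `x`. All large lengths `k` are needed because the number of
children of the node to be lifted is imposed, and the height `D` must not depend on the threshold
`m`. -/
theorem exists_overComp_of_mem_gen {E : UpSet M} (hE : IsIdempotentElem E) {x : M}
    (hx : x ∈ E.gen) : ∃ D, ∀ m, ∃ K, ∀ k, K ≤ k → ∃ es : List M, es.length = k ∧
      (∀ e ∈ es, e ∈ E) ∧ HasComp (fun x y => x ≥ y) m D es x := by
  induction hx with
  | base x hx =>
    exact ⟨_, fun m => ⟨1, fun k hk => exists_overComp_of_mem hE m (by omega) hx⟩⟩
  | up x y _ hxy ih =>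
    obtain ⟨D, hD⟩ := ih
    refine ⟨D, fun m => ?_⟩
    obtain ⟨K, hK⟩ := hD m
    refine ⟨K, fun k hk => ?_⟩
    obtain ⟨es, h1, h2, h3⟩ := hK k hk
    exact ⟨es, h1, h2, HasComp.relax (r := fun x y => x ≥ y) (fun _ _ _ h1 h2 => le_trans h2 h1)
      h3 hxy⟩
  | mul x y _ _ ihx ihy =>
    obtain ⟨D, hD⟩ := ihx
    obtain ⟨D', hD'⟩ := ihy
    refine ⟨max D D' + 1, fun m => ?_⟩
    obtain ⟨K, hK⟩ := hD m
    obtain ⟨K', hK'⟩ := hD' m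
    refine ⟨K + K', fun k hk => ?_⟩
    obtain ⟨es, h1, h2, h3⟩ := hK K le_rfl
    obtain ⟨es', h1', h2', h3'⟩ := hK' (k - K) (by omega)
    refine ⟨es ++ es', by rw [List.length_append]; omega, ?_, ?_⟩
    · intro e he
      rcases List.mem_append.1 he with he | he
      · exact h2 e he
      · exact h2' e he
    · exact .binary _ _ _ x y _ (h3.height_mono (le_max_left _ _))
        (h3'.height_mono (le_max_right _ _)) (le_refl (x * y))
  | sharp e _ ih =>
    obtain ⟨D, hD⟩ := ih
    refine ⟨D + 1, fun m => ?_⟩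
    obtain ⟨K, hK⟩ := hD m
    -- `m` words of length `K` and one longer word with the remaining letters make `m + 1` children,
    -- just enough for a stabilisation node.
    refine ⟨m * K + K, fun k hk => ?_⟩
    obtain ⟨es, h1, h2, h3⟩ := hK K le_rfl
    obtain ⟨es', h1', h2', h3'⟩ := hK (k - m * K) (by omega)
    refine ⟨(List.replicate m es ++ [es']).flatten, ?_, ?_, ?_⟩
    · simp [h1, h1']
      omega
    · intro x hx
      obtain ⟨l, hl, hx⟩ := List.mem_flatten.1 hx
      rcases List.mem_append.1 hl with hl | hl
      · exact h2 x (List.eq_of_mem_replicate hl ▸ hx)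
      · exact h2' x (List.mem_singleton.1 hl ▸ hx)
    · refine .stabilisation _ _ e _ (by simp) ?_ (le_refl _)
      intro l hl
      rcases List.mem_append.1 hl with hl | hl
      · exact List.eq_of_mem_replicate hl ▸ h3
      · exact List.mem_singleton.1 hl ▸ h3'

/-- There are finitely many pairs `(E, x)`, so maxima can be taken, while `D` stays independent of
`m`. -/
theorem exists_uniform_overComp_of_mem_gen (M : Type*) [StabilisationMonoid M] :
    ∃ D, ∀ m, ∃ K, ∀ E : UpSet M, IsIdempotentElem E → ∀ x ∈ E.gen, ∀ k, K ≤ k →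
      ∃ es : List M, es.length = k ∧ (∀ e ∈ es, e ∈ E) ∧
        HasComp (fun x y => x ≥ y) m D es x := by
  have : Finite M := StabilisationMonoid.finite
  have : Finite (UpSet M) := StabilisationMonoid.finite
  choose D hD using fun i : {q : UpSet M × M // IsIdempotentElem q.1 ∧ q.2 ∈ q.1.gen} =>
    exists_overComp_of_mem_gen i.2.1 i.2.2
  choose K hK using hD
  obtain ⟨D', hD'⟩ := Finite.exists_le D
  refine ⟨D', fun m => ?_⟩
  obtain ⟨K', hK'⟩ := Finite.exists_le fun i => K i m
  refine ⟨K', fun E hE x hx k hk => ?_⟩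
  obtain ⟨es, h1, h2, h3⟩ := hK ⟨(E, x), hE, hx⟩ m k ((hK' _).trans hk)
  exact ⟨es, h1, h2, h3.height_mono (hD' _)⟩

theorem exists_pairs_of_length_eq {m q : ℕ} {E : UpSet M} :
    ∀ (us : List (List (UpSet M))) (es : List M), es.length = us.length →
      (∀ u ∈ us, ∀ x ∈ E, ∃ xs, List.Forall₂ (fun (x : M) X => x ∈ X) xs u ∧
        HasComp (fun x y => x ≥ y) m q xs x) →
      (∀ e ∈ es, e ∈ E) →
        ∃ ps : List (M × List M), ps.map Prod.fst = es ∧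
          (∀ x ∈ ps, HasComp (fun x y => x ≥ y) m q x.2 x.1) ∧
          List.Forall₂ (fun (x : M) X => x ∈ X) (ps.flatMap Prod.snd) us.flatten
  | [], [], _, _, _ => ⟨[], rfl, by simp, by simp⟩
  | u :: us, e :: es, hl, hus, hes => by
    obtain ⟨xs, h1, h2⟩ := hus u (by simp) e (hes e (by simp))
    obtain ⟨ps, rfl, h3, h4⟩ := exists_pairs_of_length_eq us es (by simpa using hl)
      (fun u hu => hus u (by simp [hu])) fun e he => hes e (by simp [he])
    refine ⟨(e, xs) :: ps, rfl, ?_, ?_⟩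
    · intro y hy
      rcases List.mem_cons.1 hy with rfl | hy
      · exact h2
      · exact h3 y hy
    · rw [List.flatMap_cons, List.flatten_cons]
      exact List.rel_append h1 h4

/-- An over-computation with large threshold over upward closed sets induces, for every element
of its value, an over-computation for some choice of elements in the letters. -/
theorem exists_overComp_of_over (M : Type*) [StabilisationMonoid M] :
    ∃ D, ∀ m, ∃ K, ∀ n, K ≤ n → ∀ (p : ℕ) (w : List (UpSet M)) (X : UpSet M),
      HasComp (fun x y => x ≥ y) n p w X → ∀ x ∈ X,
        ∃ xs, List.Forall₂ (fun (x : M) X => x ∈ X) xs w ∧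
          HasComp (fun x y => x ≥ y) m (D * p) xs x := by
  obtain ⟨D, hD⟩ := exists_uniform_overComp_of_mem_gen M
  refine ⟨D + compBound (Nat.card M) + 1, fun m => ?_⟩
  obtain ⟨K, hK⟩ := hD m
  refine ⟨K, fun n hn p w X h => ?_⟩
  have hr : ∀ x y z : M, x ≥ y → y ≥ z → x ≥ z := fun _ _ _ h1 h2 => le_trans h2 h1
  induction h with
  | leaf p a v hv => exact fun x hx => ⟨[x], by simpa using hv x hx, .leaf _ _ _ (le_refl x)⟩
  | binary p u₁ u₂ X Y v h₁ h₂ hv ih₁ ih₂ =>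
    intro x hx
    obtain ⟨a, ha, b, hb, hx⟩ := hv x hx
    obtain ⟨xs, hxs, hca⟩ := ih₁ a ha
    obtain ⟨ys, hys, hcb⟩ := ih₂ b hb
    refine ⟨xs ++ ys, List.rel_append hxs hys, ?_⟩
    exact (HasComp.binary (r := fun x y => x ≥ y) _ _ _ _ _ x hca hcb hx).height_mono
      (by nlinarith)
  | idempotent p us e v h2 _ h hv ih =>
    intro x hx
    obtain ⟨es, h1, h3, h4⟩ := exists_overComp_of_mem e.2 m (k := us.length) (by omega) (hv x hx)
    obtain ⟨ps, rfl, h5, h6⟩ := exists_pairs_of_length_eq us es h1 ih h3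
    exact ⟨_, h6, (HasComp.bind (r := fun x y => x ≥ y) hr h4 ps rfl h5).height_mono
      (by nlinarith)⟩
  | stabilisation p us e v hlt h hv ih =>
    intro x hx
    obtain ⟨es, h1, h3, h4⟩ := hK e e.2 x (hv x hx) us.length (by omega)
    obtain ⟨ps, rfl, h5, h6⟩ := exists_pairs_of_length_eq us es h1 ih h3
    exact ⟨_, h6, (HasComp.bind (r := fun x y => x ≥ y) hr h4 ps rfl h5).height_mono
      (by nlinarith)⟩

end Lift

/-! ### Morphisms -/

/-- Morphisms of stabilisation monoids. -/
structure IsMorphism {M N : Type*} [StabilisationMonoid M] [StabilisationMonoid N] (f : M → N) :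
    Prop where
  map_one : f 1 = 1
  map_mul : ∀ x y, f (x * y) = f x * f y
  map_mono : ∀ x y, x ≤ y → f x ≤ f y
  map_sharp : ∀ (e : M) (he : IsIdempotentElem e) (he' : IsIdempotentElem (f e)),
    f (sharp ⟨e, he⟩ : M) = sharp ⟨f e, he'⟩

section Morphism

variable {M N : Type*} [StabilisationMonoid M] [StabilisationMonoid N] {f : M → N}

theorem HasComp.map (hf : IsMorphism f) {r : M → M → Prop} {r' : N → N → Prop}
    (hr : ∀ x y, r x y → r' (f x) (f y)) {n p : ℕ} {u : List M} {a : M}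
    (h : HasComp r n p u a) : HasComp r' n p (u.map f) (f a) := by
  have hid : ∀ e : {e : M // IsIdempotentElem e}, IsIdempotentElem (f e) := by
    intro e
    rw [IsIdempotentElem, ← hf.map_mul, e.2.eq]
  induction h with
  | leaf p a v hv => exact .leaf _ _ _ (hr _ _ hv)
  | binary p u₁ u₂ x y v h₁ h₂ hv ih₁ ih₂ =>
    rw [List.map_append]
    exact .binary _ _ _ _ _ _ ih₁ ih₂ (hf.map_mul x y ▸ hr _ _ hv)
  | idempotent p us e v h2 hn h hv ih =>
    rw [List.map_flatten]
    exact .idempotent _ _ ⟨f e, hid e⟩ _ (by simpa using h2) (by simpa using hn)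
      (by simpa using ih) (hr _ _ hv)
  | stabilisation p us e v hn h hv ih =>
    rw [List.map_flatten]
    exact .stabilisation _ _ ⟨f e, hid e⟩ _ (by simpa using hn)
      (by simpa using ih) (hf.map_sharp e e.2 (hid e) ▸ hr _ _ hv)

theorem EraseOnes.map (h1 : f 1 = 1) {v u : List M} (h : EraseOnes v u) :
    EraseOnes (v.map f) (u.map f) := by
  induction h with
  | nil => exact .nil
  | keep a v u _ ih => exact .keep _ _ _ ih
  | erase v u _ ih =>
    rw [List.map_cons, h1]
    exact .erase _ _ ih

theorem HasSMComp.map (hf : IsMorphism f) {r : M → M → Prop} {r' : N → N → Prop}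
    (hr : ∀ x y, r x y → r' (f x) (f y)) {n p : ℕ} {u : List M} {a : M}
    (h : HasSMComp r n p u a) : HasSMComp r' n p (u.map f) (f a) := by
  obtain ⟨v, hv, h⟩ := h
  exact ⟨_, hv.map hf.map_one, h.map hf hr⟩

end Morphism

theorem EraseOnes.refl {M : Type*} [One M] : ∀ u : List M, EraseOnes u u
  | [] => .nil
  | a :: u => .keep a u u (EraseOnes.refl u)

theorem exists_hasSMComp {M : Type*} [StabilisationMonoid M] (n : ℕ) (u : List M) :
    ∃ a, HasSMComp (fun x y => x = y) n (compBound (Nat.card M)) u a := by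
  by_cases hu : u = []
  · subst hu
    exact ⟨1, [1], .erase _ _ .nil, .leaf _ _ _ rfl⟩
  · obtain ⟨a, ha⟩ := exists_exactComp n u hu
    exact ⟨a, u, EraseOnes.refl u, ha⟩

/-! ### Recognition of the sup-projection -/

section Recognition

variable {A B M : Type*} [StabilisationMonoid M]

/-- The upward closed set generated by the images of the letters projecting to `b`. -/
def letterSet (h : A → M) (z : A → B) (b : B) : UpSet M :=
  ⟨{x | ∃ a, z a = b ∧ h a ≤ x}, fun _ _ hxy ⟨a, ha, hx⟩ => ⟨a, ha, hx.trans hxy⟩⟩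

/-- The ideal of the upward closed sets that meet the ideal `I`. -/
def meetIdeal (I : LowerSet M) : LowerSet (UpSet M) :=
  ⟨{X | ∃ x ∈ X, x ∈ I}, fun _ _ hXY ⟨x, hx, hI⟩ => ⟨x, hXY x hx, hI⟩⟩

/-- The preimage of an ideal by a monotone mapping. -/
def comapIdeal {P Q : Type*} [Preorder P] [Preorder Q] (f : P → Q) (hf : ∀ x y, x ≤ y → f x ≤ f y)
    (I : LowerSet Q) : LowerSet P :=
  ⟨{x | f x ∈ I}, fun _ _ hxy hx => I.lower (hf _ _ hxy) hx⟩

theorem mem_comapIdeal {P Q : Type*} [Preorder P] [Preorder Q] {f : P → Q}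
    {hf : ∀ x y, x ≤ y → f x ≤ f y} {I : LowerSet Q} {x : P} :
    x ∈ comapIdeal f hf I ↔ f x ∈ I := Iff.rfl

theorem semInf_le_semInf_of_imp {r r' : M → M → Prop} (hr : ∀ x y, r x y → r' x y) (h : A → M)
    (I : LowerSet M) {p q : ℕ} (hpq : p ≤ q) (u : List A) :
    semInf r' h I q u ≤ semInf r h I p u := by
  refine sInf_le_sInf ?_
  rintro _ ⟨n, rfl, a, ha, v, hv, hc⟩
  exact ⟨n, rfl, a, ha, v, hv, (hc.imp hr).height_mono hpq⟩

theorem semSup_le_semSup_of_imp {r r' : M → M → Prop} (hr : ∀ x y, r x y → r' x y) (h : A → M)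
    (I : LowerSet M) {p q : ℕ} (hpq : p ≤ q) (u : List A) :
    semSup r h I p u ≤ semSup r' h I q u := by
  refine sSup_le_sSup ?_
  rintro _ ⟨n, rfl, a, ha, v, hv, hc⟩
  exact ⟨n, rfl, a, ha, v, hv, (hc.imp hr).height_mono hpq⟩

/-- If the supremum is a finite `n`, a computation of threshold `n` cannot have its value in `I`, as
it would contribute `n + 1`; so it witnesses the infimum. -/
theorem semInf_le_semSup {r : M → M → Prop} (h : A → M) (I : LowerSet M) {p : ℕ} (u : List A)
    (hex : ∀ n, ∃ a, HasSMComp r n p (u.map h) a) : semInf r h I p u ≤ semSup r h I p u := by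
  generalize hs : semSup r h I p u = s
  induction s using ENat.recTopCoe with
  | top => exact le_top
  | coe n =>
    obtain ⟨a, ha⟩ := hex n
    by_cases haI : a ∈ I
    · have : ((n : ℕ∞) + 1) ≤ semSup r h I p u := le_sSup ⟨n, rfl, a, haI, ha⟩
      rw [hs] at this
      exact absurd this (not_le.2 (by exact_mod_cast Nat.lt_succ_self n))
    · exact sInf_le ⟨n, rfl, a, haI, ha⟩

theorem exists_eraseOnes_of_forall₂ {w w' : List (UpSet M)} (h : EraseOnes w w') :
    ∀ ys, List.Forall₂ (fun (x : M) X => x ∈ X) ys w' →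
      ∃ xs, EraseOnes xs ys ∧ List.Forall₂ (fun (x : M) X => x ∈ X) xs w := by
  induction h with
  | nil => rintro _ ⟨⟩; exact ⟨[], .nil, .nil⟩
  | keep a v u _ ih =>
    rintro _ (_ | ⟨h1, h2⟩)
    obtain ⟨xs, h3, h4⟩ := ih _ h2
    exact ⟨_ :: xs, .keep _ _ _ h3, .cons h1 h4⟩
  | erase v u _ ih =>
    intro ys hys
    obtain ⟨xs, h3, h4⟩ := ih _ hys
    exact ⟨1 :: xs, .erase _ _ h3, .cons (UpSet.mem_one.2 le_rfl) h4⟩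

theorem forall₂_letterSet (h : A → M) (z : A → B) :
    ∀ u : List A, List.Forall₂ (fun (x : M) X => x ∈ X) (u.map h) ((u.map z).map (letterSet h z))
  | [] => .nil
  | a :: u => .cons ⟨a, rfl, le_rfl⟩ (forall₂_letterSet h z u)

/-- An element chosen in a `letterSet` dominates some `h a`, and one chosen in an erased unit
dominates `1`; the word of these lower elements comes from a word over `A`. -/
theorem exists_lift_of_forall₂ (h : A → M) (z : A → B) {w w' : List (UpSet M)}
    (hw : EraseOnes w w') :
    ∀ (v : List B), w' = v.map (letterSet h z) →
      ∀ xs, List.Forall₂ (fun (x : M) X => x ∈ X) xs w →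
      ∃ (u : List A) (xs' : List M), u.map z = v ∧ EraseOnes xs' (u.map h) ∧
        List.Forall₂ (fun x' x => x' ≤ x) xs' xs := by
  induction hw with
  | nil =>
    rintro v hv _ ⟨⟩
    rw [eq_comm, List.map_eq_nil_iff] at hv
    exact ⟨[], [], by simp [hv], .nil, .nil⟩
  | keep a v u _ ih =>
    rintro v' hv _ (_ | ⟨h1, h2⟩)
    rw [eq_comm, List.map_eq_cons_iff] at hv
    obtain ⟨b, v', rfl, rfl, hv⟩ := hv
    obtain ⟨c, rfl, hc⟩ := h1
    obtain ⟨u', xs', rfl, h4, h5⟩ := ih v' hv.symm _ h2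
    exact ⟨c :: u', h c :: xs', rfl, .keep _ _ _ h4, .cons hc h5⟩
  | erase v u _ ih =>
    rintro v' hv _ (_ | ⟨h1, h2⟩)
    obtain ⟨u', xs', rfl, h4, h5⟩ := ih v' hv _ h2
    exact ⟨u', 1 :: xs', rfl, .erase _ _ h4, .cons h1 h5⟩

theorem HasComp.of_forall₂_le {n p : ℕ} {xs xs' : List M} {x : M}
    (h : HasComp (fun x y => x ≥ y) n p xs x) (hxs : List.Forall₂ (fun x' x => x' ≤ x) xs' xs) :
    HasComp (fun x y => x ≥ y) n p xs' x := by
  have key : ∃ ps : List (M × List M), ps.map Prod.fst = xs ∧ ps.flatMap Prod.snd = xs' ∧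
      ∀ y ∈ ps, HasComp (fun x y => x ≥ y) n 0 y.2 y.1 := by
    clear h
    induction hxs with
    | nil => exact ⟨[], rfl, rfl, by simp⟩
    | @cons a b l l' hab _ ih =>
      obtain ⟨ps, rfl, rfl, h⟩ := ih
      refine ⟨(b, [a]) :: ps, rfl, rfl, ?_⟩
      intro y hy
      rcases List.mem_cons.1 hy with rfl | hy
      · exact .leaf _ _ _ hab
      · exact h y hy
  obtain ⟨ps, h1, rfl, h2⟩ := key
  exact HasComp.bind (r := fun x y => x ≥ y) (fun _ _ _ h1 h2 => le_trans h2 h1) h ps h1 h2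

/-- If the value `X` avoids `I`, the exact computation induced for each preimage of `v` has its
value in `X`, hence outside `I`, at the same threshold. -/
theorem supProj_semInf_le (h : A → M) (z : A → B) (I : LowerSet M) (p q : ℕ)
    (hq : (compBound (Nat.card M) + 1) * p ≤ q) (v : List B) :
    supProj z (semInf (fun x y => x = y) h I q) v ≤
      semInf (fun x y => x ≤ y) (letterSet h z) (meetIdeal I) p v := by
  refine le_sInf ?_
  rintro _ ⟨n, rfl, X, hX, w, hw, hc⟩
  refine sSup_le ?_
  rintro _ ⟨u, rfl, rfl⟩
  obtain ⟨xs, h1, h2⟩ := exists_eraseOnes_of_forall₂ hw _ (forall₂_letterSet h z u)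
  obtain ⟨x, hx, hcx⟩ := exists_exactComp_of_under hc xs h2
  exact sInf_le ⟨n, rfl, x, fun hxI => hX ⟨x, hx, hxI⟩, xs, h1, hcx.height_mono hq⟩

theorem exists_domBy_supProj_semSup (h : A → M) (z : A → B) (I : LowerSet M) (p : ℕ) :
    ∃ q₀, ∀ q, q₀ ≤ q → ∃ α, IsCorrection α ∧
      DomBy α (semSup (fun x y => x ≥ y) (letterSet h z) (meetIdeal I) p)
        (supProj z (semSup (fun x y => x ≥ y) h I q)) := by
  obtain ⟨D, hD⟩ := exists_overComp_of_over M
  choose K hK using hD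
  -- The partial sums give a non-decreasing bound for `K`, and the summand `s` ensures `s ≤ α s`. A
  -- threshold `n ≥ K s` would yield a preimage whose supremum is at least `s + 1`.
  refine ⟨D * p, fun q hq => ⟨fun s => ∑ i ∈ Finset.range (s + 1), K i + s, ⟨?_, ?_⟩, ?_⟩⟩
  · intro s t hst
    refine add_le_add (Finset.sum_le_sum_of_subset ?_) hst
    exact Finset.range_subset_range.2 (by omega)
  · exact fun n => Nat.le_add_left _ _
  · intro v
    generalize hs : supProj z (semSup (fun x y => x ≥ y) h I q) v = s
    induction s using ENat.recTopCoe with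
    | top => exact le_top
    | coe s =>
      refine sSup_le ?_
      rintro _ ⟨n, rfl, X, ⟨x, hxX, hxI⟩, w, hw, hc⟩
      have hn : n < K s := by
        by_contra hn
        obtain ⟨xs, h1, h2⟩ := hK s n (not_lt.1 hn) p w X hc x hxX
        obtain ⟨u, xs', rfl, h4, h5⟩ := exists_lift_of_forall₂ h z hw _ rfl xs h1
        have h6 : (s : ℕ∞) + 1 ≤ semSup (fun x y => x ≥ y) h I q u :=
          le_sSup ⟨s, rfl, x, hxI, xs', h4, (h2.of_forall₂_le h5).height_mono hq⟩
        have h7 : semSup (fun x y => x ≥ y) h I q u ≤ s := hs ▸ le_sSup ⟨u, rfl, rfl⟩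
        exact absurd (h6.trans h7) (not_le.2 (by exact_mod_cast Nat.lt_succ_self s))
      have h8 : K s ≤ ∑ i ∈ Finset.range (s + 1), K i :=
        Finset.single_le_sum (f := K) (fun _ _ => Nat.zero_le _) (by simp)
      have h9 : n + 1 ≤ ∑ i ∈ Finset.range (s + 1), K i + s := by omega
      change ((n : ℕ∞) + 1) ≤ ((∑ i ∈ Finset.range (s + 1), K i + s : ℕ) : ℕ∞)
      exact_mod_cast h9

theorem CostFunction.mk_eq_of_between {E : Type*} {g₁ g₂ f s : E → ℕ∞} {α : ℕ → ℕ}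
    (hα : IsCorrection α) (h₁ : ∀ x, g₁ x ≤ f x) (h₂ : ∀ x, f x ≤ s x) (h₃ : DomBy α s g₂)
    (hg : CostFunction.mk g₁ = CostFunction.mk g₂) :
    CostFunction.mk f = CostFunction.mk g₁ := by
  obtain ⟨β, hβ, h12, h21⟩ : CostEquiv g₁ g₂ := Quotient.exact hg
  have hfg : DomBy (fun n => α (β n)) f g₁ :=
    DomBy.trans hα.1 (fun _ => le_rfl) (fun x => (h₂ x).trans (h₃ x)) h21
  refine Quotient.sound ⟨fun n => α (β n), ⟨hα.1.comp hβ.1, fun n => (hβ.2 n).trans (hα.2 _)⟩,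
    hfg, fun x => (h₁ x).trans ?_⟩
  generalize f x = y
  induction y using ENat.recTopCoe with
  | top => exact le_top
  | coe n => exact Nat.cast_le.2 ((hβ.2 n).trans (hα.2 _))

theorem mk_supProj {z : A → B} (f : List A → ℕ∞) :
    CostFunction.mk (supProj z f) = (CostFunction.mk f).supProj z := rfl

theorem semInf_comp_le {N P : Type*} [StabilisationMonoid N] [StabilisationMonoid P] {φ : N → P}
    (hφ : IsMorphism φ) {r : N → N → Prop} {r' : P → P → Prop}
    (hr : ∀ x y, r x y → r' (φ x) (φ y)) (h : A → N) (I : LowerSet P) (p : ℕ) (u : List A) :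
    semInf r' (fun a => φ (h a)) I p u ≤ semInf r h (comapIdeal φ hφ.map_mono I) p u := by
  refine sInf_le_sInf ?_
  rintro _ ⟨n, rfl, a, ha, hc⟩
  refine ⟨n, rfl, φ a, ha, ?_⟩
  have := hc.map hφ hr
  rw [List.map_map] at this
  exact this

theorem semSup_le_comp {N P : Type*} [StabilisationMonoid N] [StabilisationMonoid P] {φ : N → P}
    (hφ : IsMorphism φ) {r : N → N → Prop} {r' : P → P → Prop}
    (hr : ∀ x y, r x y → r' (φ x) (φ y)) (h : A → N) (I : LowerSet P) (p : ℕ) (u : List A) :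
    semSup r h (comapIdeal φ hφ.map_mono I) p u ≤ semSup r' (fun a => φ (h a)) I p u := by
  refine sSup_le_sSup ?_
  rintro _ ⟨n, rfl, a, ha, hc⟩
  refine ⟨n, rfl, φ a, ha, ?_⟩
  have := hc.map hφ hr
  rw [List.map_map] at this
  exact this

/-- The sup-projection is recognised by every sufficiently large stabilisation monoid that
retracts onto the monoid of upward closed sets. -/
theorem recognises_supProj {N : Type*} [StabilisationMonoid N] {φ : N → UpSet M} {ι : UpSet M → N}
    (hφ : IsMorphism φ) (hι : IsMorphism ι) (hφι : ∀ X, φ (ι X) = X)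
    (hcard : compBound (Nat.card (UpSet M)) ≤ 3 * Nat.card N) {h : A → M} {z : A → B}
    {I : LowerSet M} {F : CostFunction (List A)} (hF : Recognises h I F) :
    Recognises (fun b => ι (letterSet h z b)) (comapIdeal φ hφ.map_mono (meetIdeal I))
      (F.supProj z) := by
  intro p hp
  have hex : ∀ (v : List B) n, ∃ a, HasSMComp (fun x y => x = y) n p
      (v.map fun b => ι (letterSet h z b)) a := by
    intro v n
    obtain ⟨X, w, hw, hc⟩ := exists_hasSMComp n (v.map (letterSet h z))
    have h1 : HasSMComp (fun x y => x = y) n p (v.map (letterSet h z)) X :=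
      ⟨w, hw, hc.height_mono (hcard.trans hp)⟩
    have h2 := h1.map hι (r' := fun x y => x = y) fun _ _ h => congrArg ι h
    exact ⟨_, by simpa [Function.comp_def] using h2⟩
  obtain ⟨q₀, hq₀⟩ := exists_domBy_supProj_semSup h z I p
  -- One height for both liftings that is also admissible in the recognition of `F` by `M`.
  set q := q₀ + (compBound (Nat.card M) + 1) * p + 3 * Nat.card M with hq
  obtain ⟨α, hα, hdom⟩ := hq₀ q (by omega)
  obtain ⟨-, hF1, -, hF2⟩ := hF q (by omega)
  have hφι' : (fun b => φ (ι (letterSet h z b))) = letterSet h z := funext fun b => hφι _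
  have c1 : ∀ v, supProj z (semInf (fun x y => x = y) h I q) v ≤
      semInf (fun x y => x ≤ y) (fun b => ι (letterSet h z b))
        (comapIdeal φ hφ.map_mono (meetIdeal I)) p v := by
    intro v
    refine (supProj_semInf_le h z I p q (by omega) v).trans ?_
    have := semInf_comp_le hφ (r' := fun x y => x ≤ y) (fun x y h => hφ.map_mono x y h)
      (fun b => ι (letterSet h z b)) (meetIdeal I) p v
    rwa [hφι'] at this
  have c2 : ∀ v, semInf (fun x y => x ≤ y) (fun b => ι (letterSet h z b))
        (comapIdeal φ hφ.map_mono (meetIdeal I)) p v ≤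
      semInf (fun x y => x = y) (fun b => ι (letterSet h z b))
        (comapIdeal φ hφ.map_mono (meetIdeal I)) p v :=
    semInf_le_semInf_of_imp (fun _ _ h => le_of_eq h) _ _ le_rfl
  have c3 := fun v => semInf_le_semSup (r := fun x y => x = y) (fun b => ι (letterSet h z b))
    (comapIdeal φ hφ.map_mono (meetIdeal I)) (p := p) v (hex v)
  have c4 : ∀ v, semSup (fun x y => x = y) (fun b => ι (letterSet h z b))
        (comapIdeal φ hφ.map_mono (meetIdeal I)) p v ≤
      semSup (fun x y => x ≥ y) (fun b => ι (letterSet h z b))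
        (comapIdeal φ hφ.map_mono (meetIdeal I)) p v :=
    semSup_le_semSup_of_imp (fun _ _ h => ge_of_eq h) _ _ le_rfl
  have c5 : DomBy α (semSup (fun x y => x ≥ y) (fun b => ι (letterSet h z b))
        (comapIdeal φ hφ.map_mono (meetIdeal I)) p)
      (supProj z (semSup (fun x y => x ≥ y) h I q)) := by
    intro v
    refine le_trans ?_ (hdom v)
    have := semSup_le_comp hφ (r' := fun x y => x ≥ y) (fun x y h => hφ.map_mono y x h)
      (fun b => ι (letterSet h z b)) (meetIdeal I) p v
    rwa [hφι'] at this
  have hg : CostFunction.mk (supProj z (semInf (fun x y => x = y) h I q)) =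
      CostFunction.mk (supProj z (semSup (fun x y => x ≥ y) h I q)) := by
    rw [mk_supProj, mk_supProj, hF1, hF2]
  have hFz : F.supProj z = CostFunction.mk (supProj z (semInf (fun x y => x = y) h I q)) := by
    rw [mk_supProj, hF1]
  rw [hFz]
  refine ⟨?_, ?_, ?_, ?_⟩
  · exact CostFunction.mk_eq_of_between hα c1
      (fun v => (c2 v).trans ((c3 v).trans (c4 v))) c5 hg
  · exact CostFunction.mk_eq_of_between hα (fun v => (c1 v).trans (c2 v))
      (fun v => (c3 v).trans (c4 v)) c5 hg
  · exact CostFunction.mk_eq_of_between hα (fun v => (c1 v).trans ((c2 v).trans (c3 v))) c4 c5 hg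
  · exact CostFunction.mk_eq_of_between hα
      (fun v => (c1 v).trans ((c2 v).trans ((c3 v).trans (c4 v)))) (fun _ => le_rfl) c5 hg

end Recognition

/-! ### Enlarging the monoid -/

/-- The chain `0 < 1 < ... < c` with the maximum as product and the trivial stabilisation. -/
def Chain (c : ℕ) : Type := Fin (c + 1)

namespace Chain

variable {c : ℕ}

instance : PartialOrder (Chain c) := inferInstanceAs (PartialOrder (Fin (c + 1)))

instance : Monoid (Chain c) where
  mul i j := (max (i : Fin (c + 1)) j : Fin (c + 1))
  one := (0 : Fin (c + 1))
  mul_assoc i j k := max_assoc (α := Fin (c + 1)) i j k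
  one_mul i := max_eq_right (α := Fin (c + 1)) (Fin.zero_le i)
  mul_one i := max_eq_left (α := Fin (c + 1)) (Fin.zero_le i)

theorem isIdempotentElem (i : Chain c) : IsIdempotentElem i := max_self (α := Fin (c + 1)) i

instance : StabilisationMonoid (Chain c) where
  finite := inferInstanceAs (Finite (Fin (c + 1)))
  mul_mono _ _ _ _ h h' := max_le_max (α := Fin (c + 1)) h h'
  sharp := id
  sharp_mono _ _ h := h
  sharp_consistent i j _ _ := by
    have hc : j * i = i * j := max_comm (α := Fin (c + 1)) j i
    change i * j = i * (j * i) * j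
    rw [hc, ← mul_assoc, (isIdempotentElem i).eq, mul_assoc, (isIdempotentElem j).eq]
  sharp_le _ := le_rfl
  sharp_sharp _ := rfl
  sharp_one := rfl

/-- The position of an element of the chain. -/
def toNat (i : Chain c) : ℕ := Fin.val i

/-- The element of the chain at a given position. -/
def ofNat (i : ℕ) (hi : i < c + 1) : Chain c := ⟨i, hi⟩

theorem toNat_lt (i : Chain c) : i.toNat < c + 1 := Fin.is_lt i

theorem toNat_inj {i j : Chain c} : i.toNat = j.toNat ↔ i = j := Fin.ext_iff.symm

theorem toNat_mul (i j : Chain c) : (i * j).toNat = max i.toNat j.toNat :=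
  Fin.coe_max i j

theorem card_eq : Nat.card (Chain c) = c + 1 := Nat.card_fin (c + 1)

end Chain

/-! ### Products of stabilisation monoids. -/

section Product

variable {M N : Type*} [StabilisationMonoid M] [StabilisationMonoid N]

theorem isIdempotentElem_fst {x : M × N} (h : IsIdempotentElem x) : IsIdempotentElem x.1 :=
  congrArg Prod.fst h

theorem isIdempotentElem_snd {x : M × N} (h : IsIdempotentElem x) : IsIdempotentElem x.2 :=
  congrArg Prod.snd h

instance : StabilisationMonoid (M × N) where
  finite := by
    have : Finite M := StabilisationMonoid.finite
    have : Finite N := StabilisationMonoid.finite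
    infer_instance
  mul_mono _ _ _ _ h h' := ⟨StabilisationMonoid.mul_mono _ _ _ _ h.1 h'.1,
    StabilisationMonoid.mul_mono _ _ _ _ h.2 h'.2⟩
  sharp e := ⟨(sharp ⟨_, isIdempotentElem_fst e.2⟩, sharp ⟨_, isIdempotentElem_snd e.2⟩),
    Prod.ext (sharp ⟨_, isIdempotentElem_fst e.2⟩).2 (sharp ⟨_, isIdempotentElem_snd e.2⟩).2⟩
  sharp_mono _ _ h := ⟨StabilisationMonoid.sharp_mono _ _ h.1,
    StabilisationMonoid.sharp_mono _ _ h.2⟩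
  sharp_consistent _ _ hab hba := Prod.ext
    (StabilisationMonoid.sharp_consistent _ _ (isIdempotentElem_fst hab) (isIdempotentElem_fst hba))
    (StabilisationMonoid.sharp_consistent _ _ (isIdempotentElem_snd hab) (isIdempotentElem_snd hba))
  sharp_le _ := ⟨StabilisationMonoid.sharp_le _, StabilisationMonoid.sharp_le _⟩
  sharp_sharp _ := Subtype.ext (Prod.ext
    (congrArg Subtype.val (StabilisationMonoid.sharp_sharp _))
    (congrArg Subtype.val (StabilisationMonoid.sharp_sharp _)))
  sharp_one := Prod.ext StabilisationMonoid.sharp_one StabilisationMonoid.sharp_one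

theorem isMorphism_fst : IsMorphism (Prod.fst : M × N → M) where
  map_one := rfl
  map_mul _ _ := rfl
  map_mono _ _ h := h.1
  map_sharp _ _ _ := rfl

theorem isMorphism_prodMk_one : IsMorphism fun x : M => (x, (1 : N)) where
  map_one := rfl
  map_mul _ _ := Prod.ext rfl (one_mul _).symm
  map_mono _ _ h := ⟨h, le_rfl⟩
  map_sharp _ _ _ := Prod.ext rfl StabilisationMonoid.sharp_one.symm

end Product

/-! ### Transport along a bijection. -/

section Transfer

variable {M N : Type*} [StabilisationMonoid N]

/-- Transport of the structure of stabilisation monoid along a bijection. -/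
abbrev transferMonoid (e : M ≃ N) : StabilisationMonoid M :=
  letI : Monoid M := e.monoid
  letI : PartialOrder M := PartialOrder.lift e e.injective
  have hmul : ∀ x y : M, e (x * y) = e x * e y := fun x y => e.apply_symm_apply _
  have hid : ∀ {x : M}, IsIdempotentElem x → IsIdempotentElem (e x) := fun {x} h => by
    rw [IsIdempotentElem, ← hmul, h.eq]
  have hid' : ∀ {x : N}, IsIdempotentElem x → IsIdempotentElem (e.symm x) := fun {x} h => by
    apply e.injective
    rw [hmul, e.apply_symm_apply, h.eq]
  { finite := by
      have : Finite N := StabilisationMonoid.finite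
      exact Finite.of_injective e e.injective
    mul_mono := fun a a' b b' h h' => by
      change e _ ≤ e _
      rw [hmul, hmul]
      exact StabilisationMonoid.mul_mono _ _ _ _ h h'
    sharp := fun x => ⟨e.symm (sharp ⟨e x, hid x.2⟩ : N), hid' (sharp ⟨e x, hid x.2⟩).2⟩
    sharp_mono := fun _ _ h => by
      change e _ ≤ e _
      simp only [Equiv.apply_symm_apply]
      exact StabilisationMonoid.sharp_mono _ _ h
    sharp_consistent := fun a b hab hba => by
      apply e.injective
      simp only [hmul, Equiv.apply_symm_apply]
      exact StabilisationMonoid.sharp_consistent _ _ _ _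
    sharp_le := fun x => by
      change e _ ≤ e _
      simp only [Equiv.apply_symm_apply]
      exact StabilisationMonoid.sharp_le _
    sharp_sharp := fun x => by
      apply Subtype.ext
      simp only [Equiv.apply_symm_apply]
      exact congrArg e.symm (congrArg Subtype.val (StabilisationMonoid.sharp_sharp _))
    sharp_one := by
      apply e.injective
      have h1 : e 1 = 1 := e.apply_symm_apply _
      simp only [Equiv.apply_symm_apply, h1]
      exact StabilisationMonoid.sharp_one }

theorem isMorphism_equiv (e : M ≃ N) :
    letI := transferMonoid e
    IsMorphism e :=
  letI := transferMonoid e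
  { map_one := e.apply_symm_apply _
    map_mul := fun _ _ => e.apply_symm_apply _
    map_mono := fun _ _ h => h
    map_sharp := fun _ _ _ => e.apply_symm_apply _ }

theorem IsMorphism.comp {M N P : Type*} [StabilisationMonoid M] [StabilisationMonoid N]
    [StabilisationMonoid P] {g : N → P} {f : M → N} (hg : IsMorphism g) (hf : IsMorphism f) :
    IsMorphism fun x => g (f x) where
  map_one := by rw [hf.map_one, hg.map_one]
  map_mul x y := by rw [hf.map_mul, hg.map_mul]
  map_mono x y h := hg.map_mono _ _ (hf.map_mono _ _ h)
  map_sharp x hx hx' := by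
    have : IsIdempotentElem (f x) := by rw [IsIdempotentElem, ← hf.map_mul, hx.eq]
    rw [hf.map_sharp x hx this, hg.map_sharp _ _ hx']

theorem isMorphism_equiv_symm (e : M ≃ N) :
    letI := transferMonoid e
    IsMorphism e.symm :=
  letI := transferMonoid e
  have hmul : ∀ x y : M, e (x * y) = e x * e y := fun x y => e.apply_symm_apply _
  { map_one := rfl
    map_mul := fun x y => e.injective (by rw [hmul]; simp only [Equiv.apply_symm_apply])
    map_mono := fun x y h => by
      change e _ ≤ e _
      simpa only [Equiv.apply_symm_apply] using h
    map_sharp := fun x hx hx' => by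
      change e.symm _ = e.symm _
      congr 2
      exact congrArg sharp (Subtype.ext (e.apply_symm_apply x).symm) }

end Transfer

/-! ### Computation of the tables -/

section Primrec

variable {α β : Type*} [Primcodable α] [Primcodable β]

theorem primrecPred_forall_mem {f : α → List β} {R : α → β → Prop} (hf : Primrec f)
    (hR : PrimrecPred fun q : α × β => R q.1 q.2) : PrimrecPred fun a => ∀ x ∈ f a, R a x :=
  PrimrecRel.comp (R := fun (L : List β) a => ∀ x ∈ L, R a x)
    (PrimrecRel.forall_mem_list (R := fun x a => R a x)
      (hR.comp (Primrec.pair Primrec.snd Primrec.fst))) hf Primrec.id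

theorem primrecPred_exists_mem {f : α → List β} {R : α → β → Prop} (hf : Primrec f)
    (hR : PrimrecPred fun q : α × β => R q.1 q.2) : PrimrecPred fun a => ∃ x ∈ f a, R a x :=
  PrimrecRel.comp (R := fun (L : List β) a => ∃ x ∈ L, R a x)
    (PrimrecRel.exists_mem_list (R := fun x a => R a x)
      (hR.comp (Primrec.pair Primrec.snd Primrec.fst))) hf Primrec.id

theorem primrecPred_forall_lt {f : α → ℕ} {R : α → ℕ → Prop} (hf : Primrec f)
    (hR : PrimrecPred fun q : α × ℕ => R q.1 q.2) : PrimrecPred fun a => ∀ x < f a, R a x :=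
  (primrecPred_forall_mem (Primrec.list_range.comp hf) hR).of_eq fun a => by simp

theorem primrecPred_exists_lt {f : α → ℕ} {R : α → ℕ → Prop} (hf : Primrec f)
    (hR : PrimrecPred fun q : α × ℕ => R q.1 q.2) : PrimrecPred fun a => ∃ x < f a, R a x :=
  (primrecPred_exists_mem (Primrec.list_range.comp hf) hR).of_eq fun a => by simp

theorem _root_.PrimrecPred.imp {p q : α → Prop} (hp : PrimrecPred p) (hq : PrimrecPred q) :
    PrimrecPred fun a => p a → q a :=
  (hp.not.or hq).of_eq fun _ => imp_iff_not_or.symm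

theorem _root_.PrimrecPred.iff {p q : α → Prop} (hp : PrimrecPred p) (hq : PrimrecPred q) :
    PrimrecPred fun a => p a ↔ q a :=
  ((hp.imp hq).and (hq.imp hp)).of_eq fun _ => iff_def.symm

theorem primrecPred_eq {f g : α → β} (hf : Primrec f) (hg : Primrec g) :
    PrimrecPred fun a => f a = g a := by
  classical
  exact Primrec.eq.comp hf hg

theorem primrec_two_pow {f : α → ℕ} (hf : Primrec f) : Primrec fun a => 2 ^ f a :=
  (Primrec₂.unpaired'.1 Nat.Primrec.pow).comp (Primrec.const 2) hf

theorem primrecPred_testBit {f g : α → ℕ} (hf : Primrec f) (hg : Primrec g) :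
    PrimrecPred fun a => (f a).testBit (g a) = true :=
  (primrecPred_eq (Primrec.nat_mod.comp (Primrec.nat_div.comp hf (primrec_two_pow hg))
    (Primrec.const 2)) (Primrec.const 1)).of_eq fun a => by
      rw [Nat.testBit_eq_decide_div_mod_eq, decide_eq_true_iff]

end Primrec

namespace Tables

/-- The presentations of a recogniser and of a mapping. -/
abbrev Input : Type := RecogniserCode × MapCode

/-- The number of elements of the monoid. -/
def size (c : Input) : ℕ := c.1.2.1.length

/-- The size of the source alphabet. -/
def alph (c : Input) : ℕ := c.1.2.2.2.2.1.length

/-- The table entry of the neutral element. -/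
def oneAt (c : Input) : ℕ := c.1.1

/-- The table of the product. -/
def mulAt (c : Input) (x y : ℕ) : ℕ := (c.1.2.1.getD x []).getD y 0

/-- The table of the order. -/
def leAt (c : Input) (x y : ℕ) : Bool := (c.1.2.2.1.getD x []).getD y false

/-- The table of the stabilisation. -/
def sharpAt (c : Input) (x : ℕ) : Option ℕ := c.1.2.2.2.1.getD x none

/-- The table of the mapping into the monoid. -/
def letterAt (c : Input) (x : ℕ) : ℕ := c.1.2.2.2.2.1.getD x 0

/-- The table of the ideal. -/
def idealAt (c : Input) (x : ℕ) : Bool := c.1.2.2.2.2.2.getD x false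

/-- The table of the mapping between the alphabets. -/
def mapAt (c : Input) (x : ℕ) : ℕ := c.2.2.getD x 0

/-- The part of a code beyond the bits describing a set of elements of the monoid. -/
def level (c : Input) (t : ℕ) : ℕ := t / 2 ^ size c

/-- The set with code `t` is upward closed. -/
def IsUp (c : Input) (t : ℕ) : Prop :=
  ∀ x < size c, ∀ y < size c, leAt c x y = true → t.testBit x = true → t.testBit y = true

/-- Inclusion of the sets with codes `s` and `t`. -/
def Sub (c : Input) (s t : ℕ) : Prop :=
  ∀ x < size c, s.testBit x = true → t.testBit x = true

/-- `t` is the code of the neutral element. -/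
def IsOne (c : Input) (t : ℕ) : Prop :=
  (∀ x < size c, t.testBit x = true ↔ leAt c (oneAt c) x = true) ∧ level c t = 0

/-- `t` is the code of the product of the elements with codes `a` and `b`. -/
def IsMul (c : Input) (a b t : ℕ) : Prop :=
  (∀ x < size c, t.testBit x = true ↔ ∃ y < size c, ∃ w < size c,
    a.testBit y = true ∧ b.testBit w = true ∧ leAt c (mulAt c y w) x = true) ∧
  level c t = max (level c a) (level c b)

/-- The set with code `t` is closed under the product and the stabilisation. -/
def Closed (c : Input) (t : ℕ) : Prop :=
  (∀ x < size c, ∀ y < size c, t.testBit x = true → t.testBit y = true →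
    t.testBit (mulAt c x y) = true) ∧
  ∀ x < size c, ∀ y < size c, t.testBit x = true → sharpAt c x = some y → t.testBit y = true

/-- `t` is the code of the image of the letter `b`. -/
def IsLetter (c : Input) (b t : ℕ) : Prop :=
  (∀ x < size c, t.testBit x = true ↔
    ∃ a < alph c, mapAt c a = b ∧ leAt c (letterAt c a) x = true) ∧
  level c t = 0

/-- The set with code `t` meets the ideal. -/
def Meets (c : Input) (t : ℕ) : Prop := ∃ x < size c, t.testBit x = true ∧ idealAt c x = true

/-- The order on the elements with codes `a` and `b`. -/
def Leq (c : Input) (a b : ℕ) : Prop := Sub c b a ∧ level c a ≤ level c b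

open Classical in
/-- The codes of the elements of the new monoid. -/
noncomputable def elems (c : Input) : List ℕ :=
  -- `2 ^ size c` bit patterns for each of the `2 ^ size c * 2 ^ size c + 1` positions in the chain.
  (List.range (2 ^ size c * (2 ^ size c * 2 ^ size c + 1))).filter fun t => IsUp c t

/-- `t` is the code of the stabilisation of the idempotent with code `a`. -/
def IsSharp (c : Input) (a t : ℕ) : Prop :=
  -- The generated set is described as a least closed set among finitely many codes, which replaces
  -- the inductive generation by a bounded search.
  (Sub c a t ∧ Closed c t ∧ ∀ s ∈ elems c, Sub c a s → Closed c s → Sub c t s) ∧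
  level c t = level c a

open Classical in
/-- The presentation of the recogniser of the sup-projection. -/
noncomputable def output (c : Input) : RecogniserCode :=
  ((elems c).findIdx fun t => IsOne c t,
   (elems c).map fun a => (elems c).map fun b => (elems c).findIdx fun t => IsMul c a b t,
   (elems c).map fun a => (elems c).map fun b => decide (Leq c a b),
   (elems c).map fun a =>
     if IsMul c a a a then some ((elems c).findIdx fun t => IsSharp c a t) else none,
   (List.range c.2.1).map fun b => (elems c).findIdx fun t => IsLetter c b t,
   (elems c).map fun t => decide (Meets c t))

/-! ### Primitive recursiveness of the construction. -/

section Primrec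

open _root_.Primrec

variable {α : Type*} [Primcodable α] {c : α → Input} {f g k : α → ℕ}

theorem primrec_size (hc : Primrec c) : Primrec fun a => size (c a) :=
  list_length.comp (fst.comp (snd.comp (fst.comp hc)))

theorem primrec_alph (hc : Primrec c) : Primrec fun a => alph (c a) :=
  list_length.comp (fst.comp (snd.comp (snd.comp (snd.comp (snd.comp (fst.comp hc))))))

theorem primrec_oneAt (hc : Primrec c) : Primrec fun a => oneAt (c a) :=
  fst.comp (fst.comp hc)

theorem primrec_mulAt (hc : Primrec c) (hf : Primrec f) (hg : Primrec g) :
    Primrec fun a => mulAt (c a) (f a) (g a) :=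
  (list_getD 0).comp ((list_getD []).comp (fst.comp (snd.comp (fst.comp hc))) hf) hg

theorem primrec_leAt (hc : Primrec c) (hf : Primrec f) (hg : Primrec g) :
    Primrec fun a => leAt (c a) (f a) (g a) :=
  (list_getD false).comp ((list_getD []).comp (fst.comp (snd.comp (snd.comp (fst.comp hc)))) hf) hg

theorem primrec_sharpAt (hc : Primrec c) (hf : Primrec f) :
    Primrec fun a => sharpAt (c a) (f a) :=
  (list_getD none).comp (fst.comp (snd.comp (snd.comp (snd.comp (fst.comp hc))))) hf

theorem primrec_letterAt (hc : Primrec c) (hf : Primrec f) :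
    Primrec fun a => letterAt (c a) (f a) :=
  (list_getD 0).comp (fst.comp (snd.comp (snd.comp (snd.comp (snd.comp (fst.comp hc)))))) hf

theorem primrec_idealAt (hc : Primrec c) (hf : Primrec f) :
    Primrec fun a => idealAt (c a) (f a) :=
  (list_getD false).comp (snd.comp (snd.comp (snd.comp (snd.comp (snd.comp (fst.comp hc)))))) hf

theorem primrec_mapAt (hc : Primrec c) (hf : Primrec f) :
    Primrec fun a => mapAt (c a) (f a) :=
  (list_getD 0).comp (snd.comp (snd.comp hc)) hf

theorem primrec_level (hc : Primrec c) (hf : Primrec f) : Primrec fun a => level (c a) (f a) :=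
  nat_div.comp hf (primrec_two_pow (primrec_size hc))

theorem primrecPred_eq_true {b : α → Bool} (hb : Primrec b) : PrimrecPred fun a => b a = true :=
  primrecPred_eq hb (const true)

theorem primrecPred_isUp (hc : Primrec c) (hf : Primrec f) :
    PrimrecPred fun a => IsUp (c a) (f a) := by
  refine primrecPred_forall_lt (primrec_size hc)
    (primrecPred_forall_lt (primrec_size (hc.comp fst)) ?_)
  have hc' := hc.comp (fst.comp (fst (α := α × ℕ) (β := ℕ)))
  have hf' := hf.comp (fst.comp (fst (α := α × ℕ) (β := ℕ)))
  exact (primrecPred_eq_true (primrec_leAt hc' (snd.comp fst) snd)).imp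
    ((primrecPred_testBit hf' (snd.comp fst)).imp (primrecPred_testBit hf' snd))

theorem primrecPred_sub (hc : Primrec c) (hf : Primrec f) (hg : Primrec g) :
    PrimrecPred fun a => Sub (c a) (f a) (g a) :=
  primrecPred_forall_lt (primrec_size hc)
    ((primrecPred_testBit (hf.comp fst) snd).imp (primrecPred_testBit (hg.comp fst) snd))

theorem primrecPred_isOne (hc : Primrec c) (hf : Primrec f) :
    PrimrecPred fun a => IsOne (c a) (f a) :=
  (primrecPred_forall_lt (primrec_size hc)
    ((primrecPred_testBit (hf.comp fst) snd).iff (primrecPred_eq_true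
      (primrec_leAt (hc.comp fst) (primrec_oneAt (hc.comp fst)) snd)))).and
    (primrecPred_eq (primrec_level hc hf) (const 0))

theorem primrecPred_isMul (hc : Primrec c) (hf : Primrec f) (hg : Primrec g) (hk : Primrec k) :
    PrimrecPred fun a => IsMul (c a) (f a) (g a) (k a) := by
  refine (primrecPred_forall_lt (primrec_size hc)
    ((primrecPred_testBit (hk.comp fst) snd).iff
      (primrecPred_exists_lt (primrec_size (hc.comp fst))
        (primrecPred_exists_lt (primrec_size (hc.comp (fst.comp fst))) ?_)))).and
    (primrecPred_eq (primrec_level hc hk)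
      (nat_max.comp (primrec_level hc hf) (primrec_level hc hg)))
  have h3 : Primrec fun q : ((α × ℕ) × ℕ) × ℕ => q.1.1.1 := fst.comp (fst.comp fst)
  exact (primrecPred_testBit (hf.comp h3) (snd.comp fst)).and
    ((primrecPred_testBit (hg.comp h3) snd).and
      (primrecPred_eq_true (primrec_leAt (hc.comp h3)
        (primrec_mulAt (hc.comp h3) (snd.comp fst) snd) (snd.comp (fst.comp fst)))))

theorem primrecPred_closed (hc : Primrec c) (hf : Primrec f) :
    PrimrecPred fun a => Closed (c a) (f a) := by
  have hc' := hc.comp (fst.comp (fst (α := α × ℕ) (β := ℕ)))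
  have hf' := hf.comp (fst.comp (fst (α := α × ℕ) (β := ℕ)))
  refine (primrecPred_forall_lt (primrec_size hc)
    (primrecPred_forall_lt (primrec_size (hc.comp fst)) ?_)).and
    (primrecPred_forall_lt (primrec_size hc)
      (primrecPred_forall_lt (primrec_size (hc.comp fst)) ?_))
  · exact (primrecPred_testBit hf' (snd.comp fst)).imp ((primrecPred_testBit hf' snd).imp
      (primrecPred_testBit hf' (primrec_mulAt hc' (snd.comp fst) snd)))
  · exact (primrecPred_testBit hf' (snd.comp fst)).imp
      ((primrecPred_eq (primrec_sharpAt hc' (snd.comp fst)) (option_some.comp snd)).imp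
        (primrecPred_testBit hf' snd))

theorem primrecPred_isLetter (hc : Primrec c) (hf : Primrec f) (hg : Primrec g) :
    PrimrecPred fun a => IsLetter (c a) (f a) (g a) := by
  refine (primrecPred_forall_lt (primrec_size hc)
    ((primrecPred_testBit (hg.comp fst) snd).iff
      (primrecPred_exists_lt (primrec_alph (hc.comp fst)) ?_))).and
    (primrecPred_eq (primrec_level hc hg) (const 0))
  have hc' := hc.comp (fst.comp (fst (α := α × ℕ) (β := ℕ)))
  exact (primrecPred_eq (primrec_mapAt hc' snd) (hf.comp (fst.comp fst))).and
    (primrecPred_eq_true (primrec_leAt hc' (primrec_letterAt hc' snd) (snd.comp fst)))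

theorem primrecPred_meets (hc : Primrec c) (hf : Primrec f) :
    PrimrecPred fun a => Meets (c a) (f a) :=
  primrecPred_exists_lt (primrec_size hc) ((primrecPred_testBit (hf.comp fst) snd).and
    (primrecPred_eq_true (primrec_idealAt (hc.comp fst) snd)))

theorem primrecPred_leq (hc : Primrec c) (hf : Primrec f) (hg : Primrec g) :
    PrimrecPred fun a => Leq (c a) (f a) (g a) :=
  (primrecPred_sub hc hg hf).and (nat_le.comp (primrec_level hc hf) (primrec_level hc hg))

theorem primrec_elems (hc : Primrec c) : Primrec fun a => elems (c a) := by
  classical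
  have hs := primrec_two_pow (primrec_size hc)
  have h := PrimrecRel.listFilter (R := fun (t : ℕ) (d : Input) => IsUp d t)
    (primrecPred_isUp snd fst)
  refine (h.comp (list_range.comp (nat_mul.comp hs
    (nat_add.comp (nat_mul.comp hs hs) (const 1)))) hc).of_eq fun a => ?_
  unfold elems
  congr

theorem primrecPred_isSharp (hc : Primrec c) (hf : Primrec f) (hg : Primrec g) :
    PrimrecPred fun a => IsSharp (c a) (f a) (g a) :=
  ((primrecPred_sub hc hf hg).and ((primrecPred_closed hc hg).and
    (primrecPred_forall_mem (primrec_elems hc)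
      ((primrecPred_sub (hc.comp fst) (hf.comp fst) snd).imp
        ((primrecPred_closed (hc.comp fst) snd).imp
          (primrecPred_sub (hc.comp fst) (hg.comp fst) snd)))))).and
    (primrecPred_eq (primrec_level hc hg) (primrec_level hc hf))

theorem primrec_output : Primrec output := by
  classical
  have hE : ∀ {β : Type} [Primcodable β] {d : β → Input}, Primrec d → ∀ {P : β → ℕ → Prop}
      [∀ b t, Decidable (P b t)], (PrimrecPred fun q : β × ℕ => P q.1 q.2) →
      Primrec fun b => (elems (d b)).findIdx fun t => decide (P b t) :=
    fun hd _ _ hP => list_findIdx (primrec_elems hd) hP.decide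
  unfold output
  refine pair (hE .id (primrecPred_isOne fst snd)) (pair ?_ (pair ?_ (pair ?_ (pair ?_ ?_))))
  · exact list_map (primrec_elems .id) (list_map (primrec_elems fst)
      (hE (fst.comp fst) (primrecPred_isMul (fst.comp (fst.comp fst)) (snd.comp (fst.comp fst))
        (snd.comp fst) snd)))
  · exact list_map (primrec_elems .id) (list_map (primrec_elems fst)
      (primrecPred_leq (fst.comp fst) (snd.comp fst) snd).decide)
  · exact list_map (primrec_elems .id) (ite (primrecPred_isMul fst snd snd snd)
      (option_some.comp (hE fst (primrecPred_isSharp (fst.comp fst) (snd.comp fst) snd)))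
      (const none))
  · exact list_map (list_range.comp (fst.comp snd))
      (hE fst (primrecPred_isLetter (fst.comp fst) (snd.comp fst) snd))
  · exact list_map (primrec_elems .id) (primrecPred_meets fst snd).decide

end Primrec

end Tables

namespace Tables

/-! ### Correctness of the tables -/

theorem getD_ofFn {α : Type*} {n : ℕ} (f : Fin n → α) (i : Fin n) (d : α) :
    (List.ofFn f).getD i d = f i := by
  simp [List.getD]

theorem ofFn_eq_map {α β : Type*} (l : List α) (f : α → β) (g : Fin l.length → β)
    (h : ∀ i, g i = f l[i]) : List.ofFn g = l.map f := by
  refine List.ext_getElem (by simp) fun i h₁ h₂ => ?_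
  simp only [List.getElem_ofFn, List.getElem_map]
  exact h _

theorem forall_lt_iff {α : Type*} {n : ℕ} (e : Fin n ≃ α) {P : ℕ → Prop} :
    (∀ x < n, P x) ↔ ∀ a, P (e.symm a) :=
  ⟨fun h a => h _ (e.symm a).2, fun h x hx => by simpa using h (e ⟨x, hx⟩)⟩

theorem exists_lt_iff {α : Type*} {n : ℕ} (e : Fin n ≃ α) {P : ℕ → Prop} :
    (∃ x < n, P x) ↔ ∃ a, P (e.symm a) :=
  ⟨fun ⟨x, hx, h⟩ => ⟨e ⟨x, hx⟩, by simpa using h⟩, fun ⟨a, h⟩ => ⟨_, (e.symm a).2, h⟩⟩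

theorem val_symm_inj {α : Type*} {n : ℕ} (e : Fin n ≃ α) {a b : α} :
    ((e.symm a : ℕ) = e.symm b) ↔ a = b := by
  rw [← Fin.ext_iff, e.symm.injective.eq_iff]

/-! ### Numbering a type by a list of codes. -/

section Enumeration

variable {α : Type*} {l : List ℕ} {enc : α → ℕ}

/-- The enumeration of a type given by a list of the codes of its elements. -/
noncomputable def enum (hl : l.Nodup) (henc : Function.Injective enc)
    (hmem : ∀ t, t ∈ l ↔ ∃ a, enc a = t) : Fin l.length ≃ α :=
  (Equiv.ofBijective
    (fun a => (⟨l.idxOf (enc a), List.idxOf_lt_length_iff.2 ((hmem _).2 ⟨a, rfl⟩)⟩ : Fin l.length))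
    ⟨fun a b h => by
      have h' : l.idxOf (enc a) = l.idxOf (enc b) := congrArg Fin.val h
      exact henc ((List.idxOf_inj ((hmem _).2 ⟨a, rfl⟩)).1 h'),
    fun i => by
      obtain ⟨a, ha⟩ := (hmem _).1 (List.getElem_mem i.2)
      exact ⟨a, Fin.ext (by simp only [ha]; exact hl.idxOf_getElem _ i.2)⟩⟩).symm

variable (hl : l.Nodup) (henc : Function.Injective enc) (hmem : ∀ t, t ∈ l ↔ ∃ a, enc a = t)

theorem enc_enum (i : Fin l.length) : enc (enum hl henc hmem i) = l[i] := by
  obtain ⟨a, ha⟩ := (enum hl henc hmem).symm.surjective i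
  subst ha
  rw [Equiv.apply_symm_apply]
  exact (List.getElem_idxOf _).symm

/-- The predicate singles out one code of the list, so the search stops exactly at its position. -/
theorem enum_symm_eq_findIdx (a : α) (Q : ℕ → Prop) [DecidablePred Q]
    (hQ : ∀ b, Q (enc b) ↔ b = a) :
    ((enum hl henc hmem).symm a : ℕ) = l.findIdx fun t => Q t := by
  change l.idxOf (enc a) = _
  have h : ∀ t ∈ l, decide (Q t) = (t == enc a) := by
    intro t ht
    obtain ⟨b, rfl⟩ := (hmem t).1 ht
    rw [Bool.eq_iff_iff]
    simp [hQ, henc.eq_iff]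
  have key : ∀ l' : List ℕ, (∀ t ∈ l', decide (Q t) = (t == enc a)) →
      l'.findIdx (fun t => t == enc a) = l'.findIdx fun t => Q t := by
    intro l' hl'
    induction l' with
    | nil => rfl
    | cons t l' ih =>
      rw [List.findIdx_cons, List.findIdx_cons, hl' t (by simp),
        ih fun t ht => hl' t (by simp [ht])]
  exact key l h

end Enumeration

/-! ### Binary codes of pairs of an upward closed set and a chain position. -/

section Encoding

variable {M : Type*} [StabilisationMonoid M] {m C : ℕ} (eM : Fin m ≃ M)

open Classical in
/-- The code of an upward closed set and an element of a chain. -/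
noncomputable def enc (q : UpSet M × Chain C) : ℕ :=
  Nat.ofBits (fun i : Fin m => decide (eM i ∈ q.1)) + 2 ^ m * q.2.toNat

theorem testBit_enc (q : UpSet M × Chain C) (x : M) :
    (enc eM q).testBit (eM.symm x) = true ↔ x ∈ q.1 := by
  classical
  rw [enc, add_comm, Nat.testBit_two_pow_mul_add _ (Nat.ofBits_lt_two_pow _), if_pos (eM.symm x).2,
    Nat.testBit_ofBits_lt _ _ (eM.symm x).2, decide_eq_true_iff, Fin.eta, Equiv.apply_symm_apply]

theorem enc_div (q : UpSet M × Chain C) :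
    enc eM q / 2 ^ m = q.2.toNat := by
  rw [enc, Nat.add_mul_div_left _ _ (by positivity), Nat.div_eq_of_lt (Nat.ofBits_lt_two_pow _),
    zero_add]

theorem eq_enc {q : UpSet M × Chain C} {t : ℕ}
    (h₁ : ∀ x, t.testBit (eM.symm x) = true ↔ x ∈ q.1)
    (h₂ : t / 2 ^ m = q.2.toNat) : t = enc eM q := by
  classical
  have h : t % 2 ^ m = Nat.ofBits fun i : Fin m => decide (eM i ∈ q.1) := by
    rw [← Nat.ofBits_testBit]
    congr 1
    funext i
    have := h₁ (eM i)
    rw [Equiv.symm_apply_apply] at this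
    rw [Bool.eq_iff_iff, this, decide_eq_true_iff]
  rw [enc, ← h₂, ← h, Nat.mod_add_div]

theorem enc_injective : Function.Injective (enc (C := C) eM) := by
  intro p q h
  refine Prod.ext (UpSet.ext_mem fun x => ?_) (Chain.toNat_inj.1 ?_)
  · rw [← testBit_enc eM p, ← testBit_enc eM q, h]
  · have h1 := enc_div eM p
    have h2 := enc_div eM q
    rw [h] at h1
    exact h1.symm.trans h2

end Encoding

/-! ### Agreement of the computed tables with the new monoid. -/

section Correctness

universe u v w

variable {A : Type u} {B : Type v} {M : Type w} [StabilisationMonoid M] {k l m : ℕ}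
  (eA : Fin k ≃ A) (eB : Fin l ≃ B) (eM : Fin m ≃ M) (h : A → M) (I : LowerSet M) (z : A → B)

/-- The input presenting `M, h, I` and `z`. -/
noncomputable def input : Input := (recogniserCode eA eM h I, mapCode eA eB z)

local notation "inp" => input eA eB eM h I z

theorem size_input : size inp = m := by simp [size, input, recogniserCode]

theorem alph_input : alph inp = k := by simp [alph, input, recogniserCode]

theorem oneAt_input : oneAt inp = eM.symm 1 := rfl

theorem mulAt_input (x y : M) : mulAt inp (eM.symm x) (eM.symm y) = eM.symm (x * y) := by
  simp only [mulAt, input, recogniserCode, getD_ofFn, Equiv.apply_symm_apply]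

theorem leAt_input (x y : M) : leAt inp (eM.symm x) (eM.symm y) = true ↔ x ≤ y := by
  simp only [leAt, input, recogniserCode, getD_ofFn, Equiv.apply_symm_apply, decide_eq_true_iff]

theorem sharpAt_input (x y : M) : sharpAt inp (eM.symm x) = some (eM.symm y : ℕ) ↔
    ∃ hx : IsIdempotentElem x, (sharp ⟨x, hx⟩ : M) = y := by
  classical
  simp only [sharpAt, input, recogniserCode, getD_ofFn, Equiv.apply_symm_apply]
  by_cases hx : IsIdempotentElem x
  · simp [hx, val_symm_inj]
  · simp [hx]

theorem letterAt_input (a : A) : letterAt inp (eA.symm a) = eM.symm (h a) := by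
  simp only [letterAt, input, recogniserCode, getD_ofFn, Equiv.apply_symm_apply]

theorem idealAt_input (x : M) : idealAt inp (eM.symm x) = true ↔ x ∈ I := by
  simp only [idealAt, input, recogniserCode, getD_ofFn, Equiv.apply_symm_apply, decide_eq_true_iff]

theorem mapAt_input (a : A) : mapAt inp (eA.symm a) = eB.symm (z a) := by
  simp only [mapAt, input, mapCode, getD_ofFn, Equiv.apply_symm_apply]

theorem isUp_input {t : ℕ} : IsUp inp t ↔ ∀ x y : M, x ≤ y → t.testBit (eM.symm x) = true →
    t.testBit (eM.symm y) = true := by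
  simp only [IsUp, size_input, forall_lt_iff eM, leAt_input]

/-- The new monoid, with as many chain elements as the height of computations requires. -/
abbrev NewMonoid (M : Type w) [StabilisationMonoid M] (m : ℕ) : Type w :=
  UpSet M × Chain (2 ^ m * 2 ^ m)

theorem mem_elems_input (t : ℕ) :
    t ∈ elems inp ↔ ∃ q : NewMonoid M m, enc eM q = t := by
  simp only [elems, size_input, List.mem_filter, List.mem_range, decide_eq_true_iff, isUp_input]
  constructor
  · rintro ⟨h1, h2⟩
    have h3 : t / 2 ^ m < 2 ^ m * 2 ^ m + 1 := Nat.div_lt_of_lt_mul h1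
    refine ⟨(⟨{x | t.testBit (eM.symm x) = true}, fun x y hxy hx => h2 x y hxy hx⟩,
      Chain.ofNat (t / 2 ^ m) h3), (eq_enc eM (fun x => Iff.rfl) rfl).symm⟩
  · rintro ⟨q, rfl⟩
    refine ⟨?_, fun x y hxy hx => ?_⟩
    · have h1 := q.2.toNat_lt
      rw [← enc_div eM q] at h1
      rw [Nat.div_lt_iff_lt_mul (by positivity)] at h1
      exact h1.trans_eq (mul_comm _ _)
    · rw [testBit_enc] at hx ⊢
      exact q.1.mem_of_le hx hxy

theorem level_enc (q : NewMonoid M m) :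
    level inp (enc eM q) = q.2.toNat := by
  rw [level, size_input, enc_div]

theorem eq_iff_of_level {p q : NewMonoid M m} :
    p = q ↔ (∀ x, x ∈ p.1 ↔ x ∈ q.1) ∧
      p.2.toNat = q.2.toNat :=
  ⟨by rintro rfl; exact ⟨fun _ => Iff.rfl, rfl⟩,
    fun h => Prod.ext (UpSet.ext_mem h.1) (Chain.toNat_inj.1 h.2)⟩

theorem isOne_input (q : NewMonoid M m) : IsOne inp (enc eM q) ↔ q = 1 := by
  simp only [IsOne, size_input, forall_lt_iff eM, oneAt_input, leAt_input, testBit_enc, level_enc,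
    eq_iff_of_level]
  exact Iff.rfl

theorem isMul_input (p q r : NewMonoid M m) :
    IsMul inp (enc eM p) (enc eM q) (enc eM r) ↔ r = p * q := by
  simp only [IsMul, size_input, forall_lt_iff eM, exists_lt_iff eM, mulAt_input, leAt_input,
    testBit_enc, level_enc, eq_iff_of_level]
  refine and_congr (forall_congr' fun x => iff_congr Iff.rfl ?_) ?_
  · exact ⟨fun ⟨a, b, ha, hb, hx⟩ => ⟨a, ha, b, hb, hx⟩, fun ⟨a, ha, b, hb, hx⟩ =>
      ⟨a, b, ha, hb, hx⟩⟩
  · rw [← Chain.toNat_mul]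
    exact Iff.rfl

theorem sub_input (p q : NewMonoid M m) : Sub inp (enc eM p) (enc eM q) ↔ ∀ x ∈ p.1, x ∈ q.1 := by
  simp only [Sub, size_input, forall_lt_iff eM, testBit_enc]

theorem leq_input (p q : NewMonoid M m) : Leq inp (enc eM p) (enc eM q) ↔ p ≤ q := by
  rw [Leq, sub_input, level_enc, level_enc]
  exact Iff.rfl

theorem closed_input (p : NewMonoid M m) : Closed inp (enc eM p) ↔ p.1.IsClosed := by
  simp only [Closed, size_input, forall_lt_iff eM, mulAt_input, sharpAt_input, testBit_enc,
    UpSet.IsClosed]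
  refine and_congr ⟨fun h x hx y hy => h x y hx hy, fun h x y hx hy => h x hx y hy⟩ ?_
  constructor
  · exact fun h e he => h e _ he ⟨e.2, rfl⟩
  · rintro h x y hx ⟨hid, rfl⟩
    exact h ⟨x, hid⟩ hx

theorem isSharp_input (p q : NewMonoid M m) (hp : IsIdempotentElem p) :
    IsSharp inp (enc eM p) (enc eM q) ↔ q = (sharp ⟨p, hp⟩ : NewMonoid M m) := by
  simp only [IsSharp, mem_elems_input, forall_exists_index, forall_apply_eq_imp_iff, sub_input,
    closed_input, level_enc, eq_iff_of_level]
  refine and_congr ?_ Iff.rfl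
  have hs : (sharp ⟨p, hp⟩ : NewMonoid M m).1 = p.1.gen := rfl
  rw [hs]
  constructor
  · rintro ⟨h1, h2, h3⟩ x
    -- The generated set is among the candidates; its chain component is irrelevant, as minimality
    -- only compares sets.
    exact ⟨h3 (p.1.gen, 1) (fun x hx => UpSet.subset_gen _ hx) (UpSet.isClosed_gen _) x,
      UpSet.gen_subset h2 h1⟩
  · intro hq
    have : q.1 = p.1.gen := UpSet.ext_mem hq
    rw [this]
    exact ⟨fun x hx => UpSet.subset_gen _ hx, UpSet.isClosed_gen _,
      fun s hs hc x hx => UpSet.gen_subset hc hs hx⟩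

theorem isLetter_input (b : B) (q : NewMonoid M m) :
    IsLetter inp (eB.symm b) (enc eM q) ↔ q = (letterSet h z b, 1) := by
  simp only [IsLetter, size_input, alph_input, forall_lt_iff eM, exists_lt_iff eA, mapAt_input,
    letterAt_input, leAt_input, val_symm_inj, testBit_enc, level_enc, eq_iff_of_level]
  exact Iff.rfl

theorem meets_input (q : NewMonoid M m) : Meets inp (enc eM q) ↔ q.1 ∈ meetIdeal I := by
  simp only [Meets, size_input, exists_lt_iff eM, testBit_enc, idealAt_input]
  exact Iff.rfl

theorem nodup_elems (c : Input) : (elems c).Nodup := List.nodup_range.filter _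

/-- The enumeration of the new monoid by the list of its codes. -/
noncomputable def enumNew : Fin (elems inp).length ≃ NewMonoid M m :=
  enum (nodup_elems inp) (enc_injective eM) (mem_elems_input eA eB eM h I z)

variable {M' : Type*} [StabilisationMonoid M'] (ψ : M' ≃ NewMonoid M m)

/-- Each search in `output` has a unique solution among the codes, so it returns the number of the
intended element in `enumNew`. The monoid structure on `M'` is kept abstract, subject only to `ψ`
being an isomorphism. -/
theorem output_input (hψ : IsMorphism ψ) (hψ' : ∀ x y, ψ x ≤ ψ y → x ≤ y) :
    output inp = recogniserCode eB ((enumNew eA eB eM h I z).trans ψ.symm)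
      (fun b => ψ.symm (letterSet h z b, 1))
      (comapIdeal (fun x => (ψ x).1) (isMorphism_fst.comp hψ).map_mono (meetIdeal I)) := by
  classical
  set e := enumNew eA eB eM h I z with he
  have hget : ∀ i, (elems inp)[i] = enc eM (e i) := fun i => (enc_enum _ _ _ i).symm
  have hfind : ∀ (a : NewMonoid M m) (Q : ℕ → Prop), (∀ b, Q (enc eM b) ↔ b = a) →
      (e.symm a : ℕ) = (elems inp).findIdx fun t => decide (Q t) :=
    fun a Q hQ => enum_symm_eq_findIdx (nodup_elems inp) (enc_injective eM)
      (mem_elems_input eA eB eM h I z) a Q hQ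
  have hE : ∀ i, ψ (e.trans ψ.symm i) = e i := fun i => Equiv.apply_symm_apply _ _
  have hE' : ∀ x, (e.trans ψ.symm).symm x = e.symm (ψ x) := fun _ => rfl
  generalize e.trans ψ.symm = E at hE hE'
  have hidem : ∀ i, IsIdempotentElem (E i) ↔ IsIdempotentElem (e i) := by
    intro i
    rw [IsIdempotentElem, IsIdempotentElem, ← ψ.injective.eq_iff, hψ.map_mul, hE]
  refine Prod.ext ?_ (Prod.ext ?_ (Prod.ext ?_ (Prod.ext ?_ (Prod.ext ?_ ?_))))
  · simp only [output, recogniserCode, hE', hψ.map_one]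
    rw [hfind 1 (fun t => IsOne inp t) (isOne_input eA eB eM h I z)]
  · simp only [output, recogniserCode, hE', hψ.map_mul, hE]
    symm
    refine ofFn_eq_map _ _ _ fun i => ?_
    refine ofFn_eq_map _ _ _ fun j => ?_
    rw [hget, hget]
    exact hfind _ _ (isMul_input eA eB eM h I z _ _)
  · simp only [output, recogniserCode]
    symm
    refine ofFn_eq_map _ _ _ fun i => ?_
    refine ofFn_eq_map _ _ _ fun j => ?_
    rw [hget, hget, decide_eq_decide, leq_input, ← hE i, ← hE j]
    exact ⟨hψ.map_mono _ _, hψ' _ _⟩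
  · simp only [output, recogniserCode]
    symm
    refine ofFn_eq_map _ _ _ fun i => ?_
    rw [hget, isMul_input]
    by_cases hi : IsIdempotentElem (e i)
    · rw [dif_pos ((hidem i).2 hi), if_pos hi.eq.symm]
      have hi' : IsIdempotentElem (ψ (E i)) := by rwa [hE]
      have hs : ψ (sharp ⟨E i, (hidem i).2 hi⟩ : M') = sharp ⟨e i, hi⟩ := by
        rw [hψ.map_sharp _ _ hi']
        congr 2
        exact Subtype.ext (hE i)
      rw [hE', hs, hfind _ _ fun q => isSharp_input eA eB eM h I z (e i) q hi]
    · rw [dif_neg fun h' => hi ((hidem i).1 h'), if_neg fun h' => hi h'.symm]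
  · simp only [output, recogniserCode, hE', Equiv.apply_symm_apply]
    refine List.ext_getElem (by simp [input, mapCode]) fun i h₁ h₂ => ?_
    simp only [List.getElem_map, List.getElem_range, List.getElem_ofFn]
    rw [hfind _ (fun t => IsLetter inp i t)]
    intro q
    have := isLetter_input eA eB eM h I z (eB ⟨i, by simpa using h₂⟩) q
    rwa [Equiv.symm_apply_apply] at this
  · simp only [output, recogniserCode]
    symm
    refine ofFn_eq_map _ _ _ fun i => ?_
    rw [hget, decide_eq_decide, meets_input, mem_comapIdeal, hE]

end Correctness

end Tables

/-! ### Size of the new monoid and conclusion. -/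

section Main

/-- With `K ≤ 2 ^ m` upward closed sets, `compBound K = K (3 K ^ 2 + 2)` is at most `3 K (2 ^ m * 2
^ m + 1)`; this dictates the length of the chain. -/
theorem compBound_card_upSet_le {M : Type*} [StabilisationMonoid M] {m : ℕ} (eM : Fin m ≃ M) :
    compBound (Nat.card (UpSet M)) ≤ 3 * Nat.card (Tables.NewMonoid M m) := by
  have : Finite M := StabilisationMonoid.finite
  have hM : Nat.card M = m := by rw [← Nat.card_congr eM, Nat.card_fin]
  have hK : Nat.card (UpSet M) ≤ 2 ^ m := by
    refine (Nat.card_le_card_of_injective _ UpSet.carrier_injective).trans ?_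
    have := Fintype.ofFinite M
    rw [Nat.card_eq_fintype_card, Fintype.card_set, ← Nat.card_eq_fintype_card, hM]
  rw [Nat.card_prod, Chain.card_eq, compBound]
  have := Nat.mul_le_mul hK hK
  nlinarith [Nat.zero_le (Nat.card (UpSet M))]

/-- A copy of `Fin n` without its arithmetic and order. -/
def Carrier (n : ℕ) : Type := Fin n

theorem exists_recogniser_supProj {A B M : Type*} [StabilisationMonoid M] {k l m : ℕ}
    (eA : Fin k ≃ A) (eB : Fin l ≃ B) (eM : Fin m ≃ M) (z : A → B) (h : A → M) (I : LowerSet M) :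
    ∃ (M' : Type) (_ : StabilisationMonoid M') (m' : ℕ) (eM' : Fin m' ≃ M')
      (h' : B → M') (I' : LowerSet M'),
      Tables.output (recogniserCode eA eM h I, mapCode eA eB z) =
        recogniserCode eB eM' h' I' ∧
      ∀ F : CostFunction (List A), Recognises h I F → Recognises h' I' (F.supProj z) := by
  -- The numbering of the new monoid serves also to move it into `Type`, whatever the universe of
  -- `M`.
  let ψ : Carrier _ ≃ Tables.NewMonoid M m := Tables.enumNew eA eB eM h I z
  let _ := transferMonoid ψ
  have hψ : IsMorphism ψ := isMorphism_equiv ψ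
  have hψs : IsMorphism ψ.symm := isMorphism_equiv_symm ψ
  refine ⟨Carrier _, inferInstance, _, (Tables.enumNew eA eB eM h I z).trans ψ.symm, _, _,
    Tables.output_input eA eB eM h I z ψ hψ fun _ _ h => h, fun F hF => ?_⟩
  refine recognises_supProj (isMorphism_fst.comp hψ) (hψs.comp isMorphism_prodMk_one)
    (fun X => by rw [Equiv.apply_symm_apply]) ?_ hF
  rw [Nat.card_congr ψ]
  exact compBound_card_upSet_le eM

end Main

end CostFun

theorem mainTheorem6 :
    (∀ (A B : Type*) [Finite A] [Finite B] (z : A → B) (F : CostFun.CostFunction (List A)),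
      CostFun.IsRecognisable F → CostFun.IsRecognisable (F.supProj z)) ∧
    ∃ Φ : CostFun.RecogniserCode × CostFun.MapCode → CostFun.RecogniserCode,
      Computable Φ ∧
      ∀ (A B : Type*) (k l : ℕ) (eA : Fin k ≃ A) (eB : Fin l ≃ B) (z : A → B)
        (M : Type*) [CostFun.StabilisationMonoid M] (m : ℕ) (eM : Fin m ≃ M)
        (h : A → M) (I : LowerSet M),
        ∃ (M' : Type) (_ : CostFun.StabilisationMonoid M') (m' : ℕ) (eM' : Fin m' ≃ M')
          (h' : B → M') (I' : LowerSet M'),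
          Φ (CostFun.recogniserCode eA eM h I, CostFun.mapCode eA eB z) =
            CostFun.recogniserCode eB eM' h' I' ∧
          ∀ F : CostFun.CostFunction (List A),
            CostFun.Recognises h I F → CostFun.Recognises h' I' (F.supProj z) := by
  refine ⟨?_, CostFun.Tables.output, CostFun.Tables.primrec_output.to_comp, ?_⟩
  · rintro A B _ _ z F ⟨M, _, h, I, hF⟩
    have : Finite M := CostFun.StabilisationMonoid.finite
    obtain ⟨M', _, _, _, h', I', -, hF'⟩ := CostFun.exists_recogniser_supProj
      (Finite.equivFin A).symm (Finite.equivFin B).symm (Finite.equivFin M).symm z h I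
    exact ⟨M', _, h', I', hF' F hF⟩
  · intro A B k l eA eB z M _ m eM h I
    exact CostFun.exists_recogniser_supProj eA eB eM z h I
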